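/- Let $n\ge 2$, $1<p<q<\infty$ and $\varkappa>0$. For a bounded open set $\Omega\subset\mathbb R^n$, a measurable weight $a:\Omega\to[0,\infty)$ and a function $u$ that is weakly differentiable on $\Omega$ (i.e. $u\in W^{1,1}_{\mathrm{loc}}(\Omega)$), put \[ \mathcal F[u]=\int_\Omega |\nabla u(x)|^p+a(x)|\nabla u(x)|^q\,dx\in[0,\infty],\qquad W(\Omega)=\Big\{\varphi\in W^{1,1}_0(\Omega):\ \int_\Omega |\nabla \varphi|^p+a\,|\nabla\varphi|^q\,dx<\infty\Big\}. \] Here $W^{1,1}_0(\Omega)$ is the closure of $C_c^\infty(\Omega)$ in $W^{1,1}(\Omega)$. We write $a\in\mathcal Z^{\varkappa}(\Omega)$ if $a\ge 0$ on $\Omega$ and there is a constant $C>0$ such that $a(x)\le C\,(a(y)+|x-y|^{\varkappa})$ for all $x,y\in\Omega$. A Lipschitz domain is a bounded open set that near each of its boundary points coincides, in suitable orthonormal coordinates, with the strict epigraph of a Lipschitz function. Then the following hold. (i) If $q\le p+\varkappa$, then for every Lipschitz domain $\Omega\subset\mathbb R^n$, every measurable $a\in\mathcal Z^{\varkappa}(\Omega)$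 and every weakly differentiable $u_0$ on $\Omega$ with $\mathcal F[u_0]<\infty$, \[ \inf_{v\in u_0+W(\Omega)}\mathcal F[v]=\inf_{w\in u_0+C_c^\infty(\Omega)}\mathcal F[w]. \] (ii) If $p<n<n+\varkappa<q$, then there exist a Lipschitz domain $\Omega\subset\mathbb R^n$, a weight $a\in\mathcal Z^{\varkappa}(\Omega)$ and a function $u_0\in W^{1,1}(\Omega)$ with $\mathcal F[u_0]<\infty$ such that \[ \inf_{v\in u_0+W(\Omega)}\mathcal F[v]<\inf_{w\in u_0+C_c^\infty(\Omega)}\mathcal F[w]. \] More precisely, one can take $\Omega=B_1(0)$ to be the open unit ball and $a=\ell^{\varkappa}$ with \[ \ell(x)=\frac{\max\big\{x_n^2-\sum_{i=1}^{n-1}x_i^2,\;0\big\}}{|x|}\quad(x\neq0),\qquad \ell(0)=0. \] -/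

import Mathlib

open MeasureTheory Metric Set
open scoped ENNReal NNReal ContDiff InnerProductSpace

noncomputable section

namespace DoublePhase

variable {n : ℕ}

/-- A Lipschitz domain in `ℝⁿ`: a bounded open set `Ω` which near each boundary point `x₀` is, for
some unit vector `e`, the strict epigraph in direction `e` of a Lipschitz function of the component
of `x` orthogonal to `e`. (Connectedness is not required.) -/
structure IsLipschitzDomain (Ω : Set (EuclideanSpace ℝ (Fin n))) : Prop where
  isOpen : IsOpen Ω
  isBounded : Bornology.IsBounded Ω
  local_epigraph : ∀ x₀ ∈ frontier Ω,
    ∃ r : ℝ, 0 < r ∧ ∃ e : EuclideanSpace ℝ (Fin n), ‖e‖ = 1 ∧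
      ∃ (K : ℝ≥0) (g : EuclideanSpace ℝ (Fin n) → ℝ), LipschitzWith K g ∧
        ∀ x ∈ ball x₀ r, x ∈ Ω ↔ g (x - ⟪e, x⟫_ℝ • e) < ⟪e, x⟫_ℝ

/-- The class `𝒵^ϰ(Ω)` of weights: `a ≥ 0` on `Ω` and `a(x) ≤ C (a(y) + |x - y|^ϰ)` on `Ω × Ω`. -/
def MemZ (κ : ℝ) (Ω : Set (EuclideanSpace ℝ (Fin n))) (a : EuclideanSpace ℝ (Fin n) → ℝ) : Prop :=
  (∀ x ∈ Ω, 0 ≤ a x) ∧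
    ∃ C : ℝ, 0 < C ∧ ∀ x ∈ Ω, ∀ y ∈ Ω, a x ≤ C * (a y + ‖x - y‖ ^ κ)

/-- `C_c^∞(Ω)`, its members being extended by zero to `ℝⁿ`. -/
def testFunctions (Ω : Set (EuclideanSpace ℝ (Fin n))) : Set (EuclideanSpace ℝ (Fin n) → ℝ) :=
  {φ | ContDiff ℝ ∞ φ ∧ HasCompactSupport φ ∧ tsupport φ ⊆ Ω}

/-- `G` is a weak (distributional) gradient of `u` on `Ω`, both being locally integrable there.
Only the restrictions of `u` and `G` to `Ω` matter. -/
structure HasWeakGradient (Ω : Set (EuclideanSpace ℝ (Fin n))) (u : EuclideanSpace ℝ (Fin n) → ℝ)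
    (G : EuclideanSpace ℝ (Fin n) → EuclideanSpace ℝ (Fin n)) : Prop where
  locallyIntegrableOn : LocallyIntegrableOn u Ω
  locallyIntegrableOn_grad : LocallyIntegrableOn G Ω
  integral_eq : ∀ φ ∈ testFunctions Ω,
    (∫ x in Ω, u x • gradient φ x) = -(∫ x in Ω, φ x • G x)

/-- `u ∈ W^{1,1}_loc(Ω)`. -/
def WeaklyDifferentiable (Ω : Set (EuclideanSpace ℝ (Fin n)))
    (u : EuclideanSpace ℝ (Fin n) → ℝ) : Prop :=
  ∃ G, HasWeakGradient Ω u G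

open Classical in
/-- The weak gradient `∇u` on `Ω`, which is unique up to null sets when it exists (and `0`
otherwise). -/
def weakGrad (Ω : Set (EuclideanSpace ℝ (Fin n))) (u : EuclideanSpace ℝ (Fin n) → ℝ) :
    EuclideanSpace ℝ (Fin n) → EuclideanSpace ℝ (Fin n) :=
  if h : WeaklyDifferentiable Ω u then h.choose else 0

/-- `u ∈ W^{1,1}(Ω)`. -/
structure MemW11 (Ω : Set (EuclideanSpace ℝ (Fin n))) (u : EuclideanSpace ℝ (Fin n) → ℝ) :
    Prop where
  weaklyDifferentiable : WeaklyDifferentiable Ω u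
  integrableOn : IntegrableOn u Ω
  integrableOn_grad : IntegrableOn (weakGrad Ω u) Ω

/-- `u ∈ W^{1,1}_0(Ω)`, the closure of `C_c^∞(Ω)` in `W^{1,1}(Ω)`. -/
structure MemW110 (Ω : Set (EuclideanSpace ℝ (Fin n))) (u : EuclideanSpace ℝ (Fin n) → ℝ) :
    Prop where
  memW11 : MemW11 Ω u
  approx : ∀ ε : ℝ≥0∞, 0 < ε → ∃ φ ∈ testFunctions Ω,
    (∫⁻ x in Ω, (‖u x - φ x‖ₑ + ‖weakGrad Ω u x - gradient φ x‖ₑ)) < ε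

/-- The double phase functional `ℱ[u] = ∫_Ω |∇u|^p + a |∇u|^q dx ∈ [0, ∞]`, for a weakly
differentiable `u`. -/
def energy (p q : ℝ) (a : EuclideanSpace ℝ (Fin n) → ℝ) (Ω : Set (EuclideanSpace ℝ (Fin n)))
    (u : EuclideanSpace ℝ (Fin n) → ℝ) : ℝ≥0∞ :=
  ∫⁻ x in Ω, ENNReal.ofReal (‖weakGrad Ω u x‖ ^ p + a x * ‖weakGrad Ω u x‖ ^ q)

/-- The energy space `W(Ω)`: those `φ ∈ W^{1,1}_0(Ω)` with
`∫_Ω |∇φ|^p + a |∇φ|^q dx < ∞`. -/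
def energySpace (p q : ℝ) (a : EuclideanSpace ℝ (Fin n) → ℝ)
    (Ω : Set (EuclideanSpace ℝ (Fin n))) : Set (EuclideanSpace ℝ (Fin n) → ℝ) :=
  {φ | MemW110 Ω φ ∧ energy p q a Ω φ < ⊤}

/-- `ℓ(x) = max {x_i² - ∑_{j ≠ i} x_j², 0} / |x|` (with value `0` at `x = 0`). -/
def ell (i : Fin n) (x : EuclideanSpace ℝ (Fin n)) : ℝ :=
  max (x i ^ 2 - ∑ j ∈ Finset.univ.erase i, x j ^ 2) 0 / ‖x‖

end DoublePhase

end

/-!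
Write `H(x, ξ) = |ξ|^p + a(x) |ξ|^q`.

**Absence for `q ≤ p + κ`.** By convexity of `H` it is enough to approximate `∇φ`, for each `φ` of
the energy space, by gradients of test functions in the modular `∫_Ω H(x, · )` (`ModApprox`,
`ModApprox.iInf_le`). Truncation reduces this to bounded `φ` (`HasGradZero.modApprox`), a partition
of unity to functions supported near one point of the closure of `Ω`
(`HasGradZero.modApprox_of_bounded`). Near a boundary point the Lipschitz domain is mapped into
itself by short translations in an open cone of directions
(`IsLipschitzDomain.exists_translate`), so the convolution `φ_t` of `φ`, extended by zero, with a
kernel `k_t` supported in `t` times a ball of such directions is a test function in `Ω`. As `φ` is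
bounded, `|∇φ_t| ≤ C / t`. At a given `x`, either `a(x)` is of order at most `t^κ`, and then
`a(x) |∇φ_t|^q ≤ C t^(κ - (q - p)) |∇φ_t|^p`, or `a(x)` is comparable with all values of `a` that
enter the average; in both cases Jensen's inequality bounds `H(x, ∇φ_t)` by a multiple of the
average `k_t ⋆ H( · , ∇φ)` (`density_average_le`). These averages converge in `L¹`, and dominated
convergence gives modular convergence (`HasGradZero.modApprox_of_translate`).

**Presence for `p < n < n + κ < q`.** The weight `ℓ^κ` lives in a double cone around the `x_n`-axis.
The `0`-homogeneous function `angular` equals `s` in the upper and `-s` in the lower cone and is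
smooth off the origin, so its energy is its `p`-energy, of order `s^p` as `p < n`. The datum `u₀` is
this function cut off near the origin; the difference belongs to the energy space because `n ≥ 2`
(`hasGradZero_mul_angular`). A competitor `u₀ + ψ` with a test function `ψ` is continuous at `0`, so
in one of the two cones it changes by at least `s` along every ray from the origin to the sphere.
Since `q > n + κ`, this costs at least `c s^q` (`exists_const_mul_rpow_le_energy`), and `q > p` gives
a gap for large `s` (`exists_iInf_energySpace_lt`).
-/

noncomputable section

namespace DoublePhase

open Filter Topology

variable {n : ℕ}

local notation "𝔼" n => EuclideanSpace ℝ (Fin n)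

/-! ### Classical gradients -/

theorem inner_gradient (f : (𝔼 n) → ℝ) (x v : 𝔼 n) : ⟪gradient f x, v⟫_ℝ = fderiv ℝ f x v := by
  simp [gradient]

theorem norm_gradient (f : (𝔼 n) → ℝ) (x : 𝔼 n) : ‖gradient f x‖ = ‖fderiv ℝ f x‖ := by
  simp [gradient]

theorem gradient_fun_add {f g : (𝔼 n) → ℝ} {x : 𝔼 n} (hf : DifferentiableAt ℝ f x)
    (hg : DifferentiableAt ℝ g x) :
    gradient (fun y => f y + g y) x = gradient f x + gradient g x := by
  simp [gradient, fderiv_fun_add hf hg]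

theorem gradient_fun_mul {f g : (𝔼 n) → ℝ} {x : 𝔼 n} (hf : DifferentiableAt ℝ f x)
    (hg : DifferentiableAt ℝ g x) :
    gradient (fun y => f y * g y) x = f x • gradient g x + g x • gradient f x := by
  simp [gradient, fderiv_fun_mul hf hg]

theorem gradient_fun_const_mul {f : (𝔼 n) → ℝ} {x : 𝔼 n} (c : ℝ) (hf : DifferentiableAt ℝ f x) :
    gradient (fun y => c * f y) x = c • gradient f x := by
  simp [gradient, fderiv_const_mul hf]

theorem continuous_gradient {f : (𝔼 n) → ℝ} (hf : ContDiff ℝ 1 f) : Continuous (gradient f) :=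
  (InnerProductSpace.toDual ℝ (𝔼 n)).symm.continuous.comp (hf.continuous_fderiv one_ne_zero)

theorem hasCompactSupport_gradient {f : (𝔼 n) → ℝ} (hf : HasCompactSupport f) :
    HasCompactSupport (gradient f) :=
  (hf.fderiv ℝ).comp_left (g := (InnerProductSpace.toDual ℝ (𝔼 n)).symm) (map_zero _)

theorem gradient_eq_zero_of_notMem_tsupport {f : (𝔼 n) → ℝ} {x : 𝔼 n} (hx : x ∉ tsupport f) :
    gradient f x = 0 := by
  have : fderiv ℝ f x = 0 := by
    by_contra h
    exact hx (support_fderiv_subset ℝ h)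
  simp [gradient, this]

/-! ### Test functions -/

section TestFunctions
variable {Ω : Set (𝔼 n)} {φ ψ : (𝔼 n) → ℝ}

theorem testFunctions.contDiff (h : φ ∈ testFunctions Ω) (k : ℕ) : ContDiff ℝ k φ :=
  h.1.of_le (by exact_mod_cast le_top)

theorem testFunctions.differentiable (h : φ ∈ testFunctions Ω) : Differentiable ℝ φ :=
  (testFunctions.contDiff h 1).differentiable (by simp)

theorem testFunctions.continuous_gradient (h : φ ∈ testFunctions Ω) : Continuous (gradient φ) :=
  DoublePhase.continuous_gradient (by simpa using testFunctions.contDiff h 1)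

theorem testFunctions.apply_eq_zero (h : φ ∈ testFunctions Ω) {x : 𝔼 n} (hx : x ∉ Ω) :
    φ x = 0 :=
  image_eq_zero_of_notMem_tsupport fun h' => hx (h.2.2 h')

theorem testFunctions.gradient_eq_zero (h : φ ∈ testFunctions Ω) {x : 𝔼 n} (hx : x ∉ Ω) :
    gradient φ x = 0 :=
  gradient_eq_zero_of_notMem_tsupport fun h' => hx (h.2.2 h')

theorem testFunctions.integrable (h : φ ∈ testFunctions Ω) : Integrable φ :=
  h.1.continuous.integrable_of_hasCompactSupport h.2.1

theorem testFunctions.integrable_gradient (h : φ ∈ testFunctions Ω) :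
    Integrable (gradient φ) :=
  (testFunctions.continuous_gradient h).integrable_of_hasCompactSupport
    (hasCompactSupport_gradient h.2.1)

theorem testFunctions.exists_bound (h : φ ∈ testFunctions Ω) :
    ∃ C : ℝ, 0 < C ∧ ∀ x, |φ x| ≤ C ∧ ‖gradient φ x‖ ≤ C := by
  obtain ⟨C₁, h₁⟩ := h.1.continuous.bounded_above_of_compact_support h.2.1
  obtain ⟨C₂, h₂⟩ := (testFunctions.continuous_gradient h).bounded_above_of_compact_support
    (hasCompactSupport_gradient h.2.1)
  refine ⟨max 1 (max C₁ C₂), by positivity, fun x => ⟨?_, ?_⟩⟩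
  · exact (h₁ x).trans (by simp)
  · exact (h₂ x).trans (by simp)

theorem testFunctions.zero_mem : (fun _ => 0 : (𝔼 n) → ℝ) ∈ testFunctions Ω :=
  ⟨contDiff_const, HasCompactSupport.zero, by simp [tsupport]⟩

theorem testFunctions.add_mem (h : φ ∈ testFunctions Ω) (h' : ψ ∈ testFunctions Ω) :
    (fun x => φ x + ψ x) ∈ testFunctions Ω :=
  ⟨h.1.add h'.1, h.2.1.add h'.2.1,
    (tsupport_add φ ψ).trans (union_subset h.2.2 h'.2.2)⟩

theorem testFunctions.mul_mem (h : φ ∈ testFunctions Ω) {f : (𝔼 n) → ℝ} (hf : ContDiff ℝ ∞ f) :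
    (fun x => f x * φ x) ∈ testFunctions Ω :=
  ⟨hf.mul h.1, h.2.1.mul_left, (tsupport_mul_subset_right).trans h.2.2⟩

end TestFunctions

/-! ### Weak gradients -/

section WeakGradient
variable {Ω : Set (𝔼 n)} {u v : (𝔼 n) → ℝ} {G H : (𝔼 n) → (𝔼 n)}

theorem WeaklyDifferentiable.hasWeakGradient (h : WeaklyDifferentiable Ω u) :
    HasWeakGradient Ω u (weakGrad Ω u) := by
  rw [weakGrad, dif_pos h]
  exact h.choose_spec

/-- A function that is locally integrable on `Ω` stays integrable on `Ω` when multiplied by a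
continuous function with compact support in `Ω`. -/
theorem integrableOn_smul_of_locallyIntegrableOn {F : Type*} [NormedAddCommGroup F]
    [NormedSpace ℝ F] {f : (𝔼 n) → F} {g : (𝔼 n) → ℝ} (hf : LocallyIntegrableOn f Ω)
    (hg : Continuous g) (hgc : HasCompactSupport g) (hgΩ : tsupport g ⊆ Ω) :
    IntegrableOn (fun x => g x • f x) Ω := by
  have h1 : IntegrableOn (fun x => g x • f x) (tsupport g) :=
    (hf.integrableOn_compact_subset hgΩ hgc).continuousOn_smul hg.continuousOn hgc
  exact ((integrableOn_iff_integrable_of_support_subset fun x hx => subset_tsupport g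
    (Function.support_smul_subset_left g f hx)).1 h1).integrableOn

theorem integrableOn_smul_gradient_of_locallyIntegrableOn {f φ : (𝔼 n) → ℝ}
    (hf : LocallyIntegrableOn f Ω) (hφ : φ ∈ testFunctions Ω) :
    IntegrableOn (fun x => f x • gradient φ x) Ω := by
  have h1 : IntegrableOn (fun x => f x • gradient φ x) (tsupport φ) :=
    (hf.integrableOn_compact_subset hφ.2.2 hφ.2.1).smul_continuousOn
      (testFunctions.continuous_gradient hφ).continuousOn hφ.2.1
  refine ((integrableOn_iff_integrable_of_support_subset fun x hx => ?_).1 h1).integrableOn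
  by_contra hx'
  exact hx (by simp [gradient_eq_zero_of_notMem_tsupport hx'])

theorem HasWeakGradient.ae_eq (hΩ : IsOpen Ω) (hG : HasWeakGradient Ω u G)
    (hH : HasWeakGradient Ω u H) : G =ᵐ[volume.restrict Ω] H := by
  have key := hΩ.ae_eq_zero_of_integral_contDiff_smul_eq_zero (μ := volume) (f := G - H)
    (hG.locallyIntegrableOn_grad.sub hH.locallyIntegrableOn_grad) (fun g hg hgc hgΩ => by
      have h1 := integrableOn_smul_of_locallyIntegrableOn hG.locallyIntegrableOn_grad hg.continuous
        hgc hgΩ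
      have h2 := integrableOn_smul_of_locallyIntegrableOn hH.locallyIntegrableOn_grad hg.continuous
        hgc hgΩ
      rw [← setIntegral_eq_integral_of_forall_compl_eq_zero (s := Ω)]
      · simp only [Pi.sub_apply, smul_sub]
        rw [integral_sub h1 h2, sub_eq_zero]
        exact neg_injective ((hG.integral_eq g ⟨hg, hgc, hgΩ⟩).symm.trans
          (hH.integral_eq g ⟨hg, hgc, hgΩ⟩))
      · intro x hx
        rw [testFunctions.apply_eq_zero ⟨hg, hgc, hgΩ⟩ hx, zero_smul])
  rw [Filter.EventuallyEq, ae_restrict_iff' hΩ.measurableSet]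
  filter_upwards [key] with x hx hxΩ using sub_eq_zero.1 (hx hxΩ)

theorem HasWeakGradient.weakGrad_ae_eq (hΩ : IsOpen Ω) (hG : HasWeakGradient Ω u G) :
    weakGrad Ω u =ᵐ[volume.restrict Ω] G :=
  (WeaklyDifferentiable.hasWeakGradient ⟨G, hG⟩).ae_eq hΩ hG

theorem HasWeakGradient.add (hu : HasWeakGradient Ω u G) (hv : HasWeakGradient Ω v H) :
    HasWeakGradient Ω (u + v) (G + H) where
  locallyIntegrableOn := hu.locallyIntegrableOn.add hv.locallyIntegrableOn
  locallyIntegrableOn_grad := hu.locallyIntegrableOn_grad.add hv.locallyIntegrableOn_grad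
  integral_eq φ hφ := by
    have i1 := integrableOn_smul_of_locallyIntegrableOn hu.locallyIntegrableOn_grad
      hφ.1.continuous hφ.2.1 hφ.2.2
    have i2 := integrableOn_smul_of_locallyIntegrableOn hv.locallyIntegrableOn_grad
      hφ.1.continuous hφ.2.1 hφ.2.2
    have j1 := integrableOn_smul_gradient_of_locallyIntegrableOn hu.locallyIntegrableOn hφ
    have j2 := integrableOn_smul_gradient_of_locallyIntegrableOn hv.locallyIntegrableOn hφ
    simp only [Pi.add_apply, add_smul, smul_add]
    rw [integral_add j1 j2, integral_add i1 i2, hu.integral_eq φ hφ, hv.integral_eq φ hφ]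
    abel

theorem hasWeakGradient_of_contDiff (hu : ContDiff ℝ 1 u) :
    HasWeakGradient Ω u (gradient u) where
  locallyIntegrableOn := hu.continuous.locallyIntegrable.locallyIntegrableOn _
  locallyIntegrableOn_grad := (continuous_gradient hu).locallyIntegrable.locallyIntegrableOn _
  integral_eq φ hφ := by
    have i1 := integrableOn_smul_of_locallyIntegrableOn
      ((continuous_gradient hu).locallyIntegrable.locallyIntegrableOn Ω) hφ.1.continuous hφ.2.1
      hφ.2.2
    have i2 := integrableOn_smul_gradient_of_locallyIntegrableOn
      (hu.continuous.locallyIntegrable.locallyIntegrableOn Ω) hφ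
    have j1 : Integrable (fun x => φ x • gradient u x) :=
      (hφ.1.continuous.smul (continuous_gradient hu)).integrable_of_hasCompactSupport
        hφ.2.1.smul_right
    have j2 : Integrable (fun x => u x • gradient φ x) :=
      (hu.continuous.smul (testFunctions.continuous_gradient hφ)).integrable_of_hasCompactSupport
        (hasCompactSupport_gradient hφ.2.1).smul_left
    rw [setIntegral_eq_integral_of_forall_compl_eq_zero fun x hx => by
        rw [testFunctions.gradient_eq_zero hφ hx, smul_zero],
      setIntegral_eq_integral_of_forall_compl_eq_zero fun x hx => by
        rw [testFunctions.apply_eq_zero hφ hx, zero_smul]]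
    refine ext_inner_right ℝ fun w => ?_
    have e1 : ⟪∫ x, u x • gradient φ x, w⟫_ℝ = ∫ x, u x * fderiv ℝ φ x w := by
      rw [real_inner_comm, ← integral_inner j2]
      refine integral_congr_ae (.of_forall fun x => ?_)
      simp only
      rw [inner_smul_right, real_inner_comm, inner_gradient]
    have e2 : ⟪∫ x, φ x • gradient u x, w⟫_ℝ = ∫ x, fderiv ℝ u x w * φ x := by
      rw [real_inner_comm, ← integral_inner j1]
      refine integral_congr_ae (.of_forall fun x => ?_)
      simp only
      rw [inner_smul_right, real_inner_comm, inner_gradient, mul_comm]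
    rw [inner_neg_left, e1, e2]
    have hcu : Continuous fun x => fderiv ℝ u x w :=
      (hu.continuous_fderiv one_ne_zero).clm_apply continuous_const
    have hcφ : Continuous fun x => fderiv ℝ φ x w :=
      ((testFunctions.contDiff hφ 1).continuous_fderiv (by simp)).clm_apply continuous_const
    refine integral_mul_fderiv_eq_neg_fderiv_mul_of_integrable ?_ ?_ ?_
      (fun x _ => (hu.differentiable one_ne_zero) x) fun x _ => testFunctions.differentiable hφ x
    · exact (hcu.mul hφ.1.continuous).integrable_of_hasCompactSupport hφ.2.1.mul_left
    · exact (hu.continuous.mul hcφ).integrable_of_hasCompactSupport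
        (hφ.2.1.fderiv_apply ℝ w).mul_left
    · exact (hu.continuous.mul hφ.1.continuous).integrable_of_hasCompactSupport hφ.2.1.mul_left

/-- Weak gradients pass to limits in `W^{1,1}(Ω)`. -/
theorem hasWeakGradient_of_approx (hu : LocallyIntegrableOn u Ω) (hG : LocallyIntegrableOn G Ω)
    (h : ∀ ε : ℝ≥0∞, 0 < ε → ∃ (w : (𝔼 n) → ℝ) (H : (𝔼 n) → (𝔼 n)), HasWeakGradient Ω w H ∧
      ∫⁻ x in Ω, (‖u x - w x‖ₑ + ‖G x - H x‖ₑ) < ε) :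
    HasWeakGradient Ω u G where
  locallyIntegrableOn := hu
  locallyIntegrableOn_grad := hG
  integral_eq φ hφ := by
    obtain ⟨C, hC, hφC⟩ := testFunctions.exists_bound hφ
    have iG := integrableOn_smul_of_locallyIntegrableOn hG hφ.1.continuous hφ.2.1 hφ.2.2
    have iu := integrableOn_smul_gradient_of_locallyIntegrableOn hu hφ
    have hint : IntegrableOn (fun x => u x • gradient φ x + φ x • G x) Ω := iu.add iG
    rw [← add_eq_zero_iff_eq_neg, ← integral_add iu iG, ← enorm_eq_zero]
    refine le_antisymm (ENNReal.le_of_forall_pos_le_add fun ε hε _ => ?_) zero_le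
    obtain ⟨w, H, hwH, hlt⟩ := h (ε / ENNReal.ofReal C)
      (ENNReal.div_pos (by simpa using hε.ne') ENNReal.ofReal_ne_top)
    have iH := integrableOn_smul_of_locallyIntegrableOn hwH.locallyIntegrableOn_grad
      hφ.1.continuous hφ.2.1 hφ.2.2
    have iw := integrableOn_smul_gradient_of_locallyIntegrableOn hwH.locallyIntegrableOn hφ
    have e : ∫ x in Ω, (u x • gradient φ x + φ x • G x) =
        ∫ x in Ω, ((u x • gradient φ x + φ x • G x) - (w x • gradient φ x + φ x • H x)) := by
      have hint' : IntegrableOn (fun x => w x • gradient φ x + φ x • H x) Ω := iw.add iH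
      rw [integral_sub hint hint', integral_add iw iH, hwH.integral_eq φ hφ]
      simp
    rw [e, zero_add]
    calc _ ≤ ∫⁻ x in Ω, ‖(u x • gradient φ x + φ x • G x) -
          (w x • gradient φ x + φ x • H x)‖ₑ := enorm_integral_le_lintegral_enorm _
      _ ≤ ∫⁻ x in Ω, ENNReal.ofReal C * (‖u x - w x‖ₑ + ‖G x - H x‖ₑ) := by
        refine lintegral_mono fun x => ?_
        have : (u x • gradient φ x + φ x • G x) - (w x • gradient φ x + φ x • H x) =
            (u x - w x) • gradient φ x + φ x • (G x - H x) := by module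
        simp only [this, mul_add]
        refine (enorm_add_le _ _).trans (add_le_add ?_ ?_)
        · rw [enorm_smul, mul_comm]
          gcongr
          rw [← ofReal_norm]
          exact ENNReal.ofReal_le_ofReal (hφC x).2
        · rw [enorm_smul]
          gcongr
          rw [← ofReal_norm]
          exact ENNReal.ofReal_le_ofReal (hφC x).1
      _ = ENNReal.ofReal C * ∫⁻ x in Ω, (‖u x - w x‖ₑ + ‖G x - H x‖ₑ) :=
        lintegral_const_mul' _ _ ENNReal.ofReal_ne_top
      _ ≤ ENNReal.ofReal C * (ε / ENNReal.ofReal C) := by gcongr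
      _ ≤ ε := ENNReal.mul_div_le

end WeakGradient

/-! ### Sobolev functions with zero boundary values, extended by zero -/

theorem exists_subseq_tendsto_ae {α F : Type*} [MeasurableSpace α] {μ : Measure α}
    [NormedAddCommGroup F] {f : ℕ → α → F} {g : α → F} (hf : ∀ k, AEStronglyMeasurable (f k) μ)
    (hg : AEStronglyMeasurable g μ)
    (h : Tendsto (fun k => ∫⁻ x, ‖g x - f k x‖ₑ ∂μ) atTop (𝓝 0)) :
    ∃ ns : ℕ → ℕ, StrictMono ns ∧ ∀ᵐ x ∂μ, Tendsto (fun k => f (ns k) x) atTop (𝓝 (g x)) := by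
  refine (tendstoInMeasure_of_tendsto_eLpNorm one_ne_zero hf hg ?_).exists_seq_tendsto_ae
  refine h.congr fun k => ?_
  rw [eLpNorm_one_eq_lintegral_enorm]
  exact lintegral_congr fun x => by rw [Pi.sub_apply, enorm_sub_rev]

/-- `u ∈ W^{1,1}_0(Ω)` has gradient `G`, both functions being extended by zero to `ℝⁿ`: the pair
`(u, G)` is the limit in `L¹(ℝⁿ)` of pairs `(φ, ∇φ)` with `φ ∈ C_c^∞(Ω)`. -/
structure HasGradZero (Ω : Set (𝔼 n)) (u : (𝔼 n) → ℝ) (G : (𝔼 n) → (𝔼 n)) : Prop where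
  aesm : AEStronglyMeasurable u volume
  aesm_grad : AEStronglyMeasurable G volume
  eq_zero : ∀ x ∉ Ω, u x = 0
  grad_eq_zero : ∀ x ∉ Ω, G x = 0
  approx : ∀ ε : ℝ≥0∞, 0 < ε → ∃ φ ∈ testFunctions Ω,
    ∫⁻ x, (‖u x - φ x‖ₑ + ‖G x - gradient φ x‖ₑ) < ε

section
variable {Ω : Set (𝔼 n)} {u : (𝔼 n) → ℝ} {G : (𝔼 n) → (𝔼 n)}

theorem hasGradZero_of_testFunctions {φ : (𝔼 n) → ℝ} (hφ : φ ∈ testFunctions Ω) :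
    HasGradZero Ω φ (gradient φ) where
  aesm := hφ.1.continuous.aestronglyMeasurable
  aesm_grad := (testFunctions.continuous_gradient hφ).aestronglyMeasurable
  eq_zero _ hx := testFunctions.apply_eq_zero hφ hx
  grad_eq_zero _ hx := testFunctions.gradient_eq_zero hφ hx
  approx ε hε := ⟨φ, hφ, by simpa⟩

theorem MemW110.hasGradZero (hΩ : IsOpen Ω) (h : MemW110 Ω u) :
    HasGradZero Ω (Ω.indicator u) (Ω.indicator (weakGrad Ω u)) where
  aesm := (aestronglyMeasurable_indicator_iff hΩ.measurableSet).2
    h.memW11.integrableOn.aestronglyMeasurable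
  aesm_grad := (aestronglyMeasurable_indicator_iff hΩ.measurableSet).2
    h.memW11.integrableOn_grad.aestronglyMeasurable
  eq_zero _ hx := indicator_of_notMem hx _
  grad_eq_zero _ hx := indicator_of_notMem hx _
  approx ε hε := by
    obtain ⟨φ, hφ, hlt⟩ := h.approx ε hε
    refine ⟨φ, hφ, lt_of_eq_of_lt ?_ hlt⟩
    rw [← lintegral_indicator hΩ.measurableSet]
    refine lintegral_congr fun x => ?_
    by_cases hx : x ∈ Ω
    · simp [hx]
    · simp [hx, testFunctions.apply_eq_zero hφ hx, testFunctions.gradient_eq_zero hφ hx]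

theorem HasGradZero.integrable (h : HasGradZero Ω u G) : Integrable u := by
  obtain ⟨φ, hφ, hlt⟩ := h.approx 1 one_pos
  have : Integrable (fun x => u x - φ x) :=
    ⟨h.aesm.sub hφ.1.continuous.aestronglyMeasurable,
      (lintegral_mono fun x => le_self_add).trans_lt (hlt.trans ENNReal.one_lt_top)⟩
  exact (this.add (testFunctions.integrable hφ)).congr (.of_forall fun x => by simp)

theorem HasGradZero.integrable_grad (h : HasGradZero Ω u G) : Integrable G := by
  obtain ⟨φ, hφ, hlt⟩ := h.approx 1 one_pos
  have : Integrable (fun x => G x - gradient φ x) :=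
    ⟨h.aesm_grad.sub (testFunctions.continuous_gradient hφ).aestronglyMeasurable,
      (lintegral_mono fun x => le_add_self).trans_lt (hlt.trans ENNReal.one_lt_top)⟩
  exact (this.add (testFunctions.integrable_gradient hφ)).congr (.of_forall fun x => by simp)

theorem HasGradZero.hasWeakGradient (h : HasGradZero Ω u G) (Ω' : Set (𝔼 n)) :
    HasWeakGradient Ω' u G := by
  refine hasWeakGradient_of_approx (h.integrable.locallyIntegrable.locallyIntegrableOn _)
    (h.integrable_grad.locallyIntegrable.locallyIntegrableOn _) fun ε hε => ?_
  obtain ⟨φ, hφ, hlt⟩ := h.approx ε hε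
  exact ⟨φ, gradient φ, hasWeakGradient_of_contDiff (by simpa using testFunctions.contDiff hφ 1),
    (setLIntegral_le_lintegral _ _).trans_lt hlt⟩

theorem HasGradZero.weakGrad_ae_eq (h : HasGradZero Ω u G) (hΩ : IsOpen Ω) :
    weakGrad Ω u =ᵐ[volume.restrict Ω] G :=
  (h.hasWeakGradient Ω).weakGrad_ae_eq hΩ

theorem HasGradZero.memW110 (h : HasGradZero Ω u G) (hΩ : IsOpen Ω) : MemW110 Ω u where
  memW11 := ⟨⟨G, h.hasWeakGradient Ω⟩, h.integrable.integrableOn,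
    h.integrable_grad.integrableOn.congr_fun_ae (h.weakGrad_ae_eq hΩ).symm⟩
  approx ε hε := by
    obtain ⟨φ, hφ, hlt⟩ := h.approx ε hε
    refine ⟨φ, hφ, lt_of_le_of_lt ?_ hlt⟩
    refine le_trans (le_of_eq ?_) (setLIntegral_le_lintegral Ω _)
    refine lintegral_congr_ae ?_
    filter_upwards [h.weakGrad_ae_eq hΩ] with x hx
    rw [hx]

theorem HasGradZero.exists_seq (h : HasGradZero Ω u G) :
    ∃ φ : ℕ → (𝔼 n) → ℝ, (∀ k, φ k ∈ testFunctions Ω) ∧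
      Tendsto (fun k => ∫⁻ x, (‖u x - φ k x‖ₑ + ‖G x - gradient (φ k) x‖ₑ)) atTop (𝓝 0) ∧
      ∀ᵐ x, Tendsto (fun k => φ k x) atTop (𝓝 (u x)) := by
  have h0 : ∀ k : ℕ, (0 : ℝ≥0∞) < (k + 1 : ℝ≥0∞)⁻¹ := fun k => by simp
  choose φ hφ hlt using fun k : ℕ => h.approx _ (h0 k)
  have hlim : Tendsto (fun k => ∫⁻ x, (‖u x - φ k x‖ₑ + ‖G x - gradient (φ k) x‖ₑ)) atTop
      (𝓝 0) := by
    refine tendsto_of_tendsto_of_tendsto_of_le_of_le tendsto_const_nhds ?_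
      (fun _ => zero_le) (fun k => (hlt k).le)
    have := (ENNReal.tendsto_inv_nat_nhds_zero).comp (tendsto_add_atTop_nat 1)
    simpa [Function.comp_def] using this
  obtain ⟨ns, hns, hae⟩ := exists_subseq_tendsto_ae (μ := volume)
    (fun k => (hφ k).1.continuous.aestronglyMeasurable) h.aesm
    (tendsto_of_tendsto_of_tendsto_of_le_of_le tendsto_const_nhds hlim
      (fun _ => zero_le) fun k => lintegral_mono fun x => le_self_add)
  exact ⟨fun k => φ (ns k), fun k => hφ _, hlim.comp hns.tendsto_atTop, hae⟩

/-- Chain rule in `W^{1,1}_0(Ω)`. -/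
theorem HasGradZero.comp (h : HasGradZero Ω u G) {T : ℝ → ℝ} (hT : ContDiff ℝ ∞ T) (hT0 : T 0 = 0)
    (hT1 : ∀ s, |deriv T s| ≤ 1) :
    HasGradZero Ω (fun x => T (u x)) (fun x => deriv T (u x) • G x) := by
  have hT' : Continuous (deriv T) := hT.continuous_deriv (by simp)
  have hdiff : Differentiable ℝ T := hT.differentiable (by simp)
  have hlip : ∀ s t, |T s - T t| ≤ |s - t| := fun s t => by
    have := Convex.norm_image_sub_le_of_norm_deriv_le (f := T) (C := 1) (s := univ)
      (fun x _ => hdiff x) (fun x _ => hT1 x) convex_univ (mem_univ t) (mem_univ s)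
    simpa using this
  have htest : ∀ φ ∈ testFunctions Ω, (fun x => T (φ x)) ∈ testFunctions Ω ∧
      ∀ x, gradient (fun x => T (φ x)) x = deriv T (φ x) • gradient φ x := fun φ hφ => by
    refine ⟨⟨hT.comp hφ.1, hφ.2.1.comp_left hT0, (closure_mono ?_).trans hφ.2.2⟩, fun x => ?_⟩
    · exact Function.support_comp_subset hT0 φ
    · refine ext_inner_right ℝ fun w => ?_
      rw [inner_gradient, inner_smul_left, inner_gradient]
      have e := ((hdiff (φ x)).hasDerivAt.comp_hasFDerivAt x
        (testFunctions.differentiable hφ x).hasFDerivAt).fderiv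
      have e' : fderiv ℝ (fun x => T (φ x)) x = deriv T (φ x) • fderiv ℝ φ x := e
      rw [e']
      simp
  refine ⟨hT.continuous.comp_aestronglyMeasurable h.aesm,
    (hT'.comp_aestronglyMeasurable h.aesm).smul h.aesm_grad,
    fun x hx => by simp only [h.eq_zero x hx, hT0], fun x hx => by
      simp only [h.grad_eq_zero x hx, smul_zero], fun ε hε => ?_⟩
  obtain ⟨φ, hφ, hlim, hae⟩ := h.exists_seq
  have hdct : Tendsto (fun k => ∫⁻ x, ‖(deriv T (u x) - deriv T (φ k x)) • G x‖ₑ) atTop (𝓝 0) := by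
    have := tendsto_lintegral_of_dominated_convergence' (μ := volume)
      (F := fun k x => ‖(deriv T (u x) - deriv T (φ k x)) • G x‖ₑ) (f := fun _ => 0)
      (fun x => 2 * ‖G x‖ₑ) (fun k => ?_) (fun k => .of_forall fun x => ?_) ?_ ?_
    · simpa using this
    · exact (((hT'.comp_aestronglyMeasurable h.aesm).sub (hT'.comp_aestronglyMeasurable
        (hφ k).1.continuous.aestronglyMeasurable)).smul h.aesm_grad).enorm
    · simp only
      rw [enorm_smul]
      gcongr
      have : |deriv T (u x) - deriv T (φ k x)| ≤ 2 :=
        (abs_sub _ _).trans (by linarith [hT1 (u x), hT1 (φ k x)])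
      rw [← ofReal_norm]
      exact (ENNReal.ofReal_le_ofReal this).trans (by simp)
    · rw [lintegral_const_mul' _ _ (by simp)]
      exact ENNReal.mul_ne_top (by simp) h.integrable_grad.2.ne
    · filter_upwards [hae] with x hx
      have h1 : Tendsto (fun k => (deriv T (u x) - deriv T (φ k x)) • G x) atTop (𝓝 0) := by
        have := (tendsto_const_nhds (x := deriv T (u x))).sub ((hT'.tendsto (u x)).comp hx)
        simpa using this.smul_const (G x)
      simpa using h1.enorm
  have hsum := hlim.add hdct
  rw [add_zero] at hsum
  obtain ⟨k, hk⟩ := (hsum.eventually (gt_mem_nhds hε)).exists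
  refine ⟨_, (htest _ (hφ k)).1, lt_of_le_of_lt ?_ hk⟩
  rw [← lintegral_add_right']
  · refine lintegral_mono fun x => ?_
    rw [(htest _ (hφ k)).2, add_assoc]
    refine add_le_add ?_ ?_
    · exact enorm_le_iff_norm_le.2 (hlip _ _)
    · have : deriv T (u x) • G x - deriv T (φ k x) • gradient (φ k) x =
        deriv T (φ k x) • (G x - gradient (φ k) x) + (deriv T (u x) - deriv T (φ k x)) • G x := by
        module
      rw [this]
      refine (enorm_add_le _ _).trans ?_
      gcongr
      refine enorm_le_iff_norm_le.2 ?_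
      rw [norm_smul]
      exact mul_le_of_le_one_left (norm_nonneg _) (hT1 _)
  · exact (((hT'.comp_aestronglyMeasurable h.aesm).sub (hT'.comp_aestronglyMeasurable
        (hφ k).1.continuous.aestronglyMeasurable)).smul h.aesm_grad).enorm

/-- Leibniz rule in `W^{1,1}_0(Ω)`. -/
theorem HasGradZero.mul (h : HasGradZero Ω u G) {η : (𝔼 n) → ℝ} (hη : η ∈ testFunctions univ) :
    HasGradZero Ω (fun x => η x * u x) (fun x => η x • G x + u x • gradient η x) := by
  obtain ⟨C, hC, hηC⟩ := testFunctions.exists_bound hη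
  have hc := hη.1.continuous
  have hcg := testFunctions.continuous_gradient hη
  refine ⟨hc.aestronglyMeasurable.mul h.aesm, (hc.aestronglyMeasurable.smul h.aesm_grad).add
    (h.aesm.smul hcg.aestronglyMeasurable), fun x hx => by simp only [h.eq_zero x hx, mul_zero],
    fun x hx => by simp [h.eq_zero x hx, h.grad_eq_zero x hx], fun ε hε => ?_⟩
  obtain ⟨φ, hφ, hlt⟩ := h.approx (ε / ENNReal.ofReal (2 * C))
      (ENNReal.div_pos hε.ne' ENNReal.ofReal_ne_top)
  refine ⟨_, testFunctions.mul_mem hφ hη.1, ?_⟩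
  have hpt : ∀ x, ‖η x * u x - η x * φ x‖ₑ + ‖η x • G x + u x • gradient η x -
      gradient (fun y => η y * φ y) x‖ₑ ≤
      ENNReal.ofReal (2 * C) * (‖u x - φ x‖ₑ + ‖G x - gradient φ x‖ₑ) := fun x => by
    rw [gradient_fun_mul (testFunctions.differentiable hη x) (testFunctions.differentiable hφ x)]
    simp only [← ofReal_norm]
    rw [← ENNReal.ofReal_add (by positivity) (by positivity),
      ← ENNReal.ofReal_add (by positivity) (by positivity), ← ENNReal.ofReal_mul (by positivity)]
    refine ENNReal.ofReal_le_ofReal ?_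
    have e1 : η x * u x - η x * φ x = η x * (u x - φ x) := by ring
    have e2 : η x • G x + u x • gradient η x - (η x • gradient φ x + φ x • gradient η x) =
      η x • (G x - gradient φ x) + (u x - φ x) • gradient η x := by module
    rw [e1, e2, norm_mul, Real.norm_eq_abs (η x)]
    have e3 := norm_add_le (η x • (G x - gradient φ x)) ((u x - φ x) • gradient η x)
    rw [norm_smul, norm_smul, Real.norm_eq_abs (η x)] at e3
    have := mul_le_mul_of_nonneg_right (hηC x).1 (norm_nonneg (u x - φ x))
    have := mul_le_mul_of_nonneg_right (hηC x).1 (norm_nonneg (G x - gradient φ x))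
    have := mul_le_mul_of_nonneg_left (hηC x).2 (norm_nonneg (u x - φ x))
    nlinarith [norm_nonneg (G x - gradient φ x)]
  refine (lintegral_mono hpt).trans_lt ?_
  rw [lintegral_const_mul' _ _ ENNReal.ofReal_ne_top]
  have hpos : ENNReal.ofReal (2 * C) ≠ 0 := by simpa using hC
  calc _ < ENNReal.ofReal (2 * C) * (ε / ENNReal.ofReal (2 * C)) :=
        (ENNReal.mul_lt_mul_iff_right hpos ENNReal.ofReal_ne_top).2 hlt
    _ ≤ ε := ENNReal.mul_div_le

end

/-! ### The double phase density and modular approximation -/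

/-- The double phase density `r^p + a(x) r^q`, with values in `[0, ∞]`. -/
def density (p q : ℝ) (a : (𝔼 n) → ℝ) (x : 𝔼 n) (r : ℝ) : ℝ≥0∞ :=
  ENNReal.ofReal (r ^ p + a x * r ^ q)

theorem add_rpow_le_weighted {s t l p : ℝ} (hs : 0 ≤ s) (ht : 0 ≤ t) (hl0 : 0 < l) (hl1 : l < 1)
    (hp : 1 ≤ p) : (s + t) ^ p ≤ l ^ (1 - p) * s ^ p + (1 - l) ^ (1 - p) * t ^ p := by
  have h1 : 0 < 1 - l := by linarith
  have := (convexOn_rpow hp).2 (x := s / l) (y := t / (1 - l)) (mem_Ici.2 (by positivity))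
    (mem_Ici.2 (by positivity)) hl0.le h1.le (by ring)
  have key : ∀ m r : ℝ, 0 < m → 0 ≤ r → m * (r / m) ^ p = m ^ (1 - p) * r ^ p := fun m r hm hr => by
    rw [Real.div_rpow hr hm.le, Real.rpow_sub hm, Real.rpow_one]
    field_simp
  simp only [smul_eq_mul, key _ _ hl0 hs, key _ _ h1 ht] at this
  rwa [mul_div_cancel₀ _ hl0.ne', mul_div_cancel₀ _ h1.ne'] at this

section
variable {p q : ℝ} {a : (𝔼 n) → ℝ} {x : 𝔼 n} {Ω : Set (𝔼 n)}

theorem density_mono (hp : 0 < p) (hq : 0 < q) (ha : 0 ≤ a x) {r s : ℝ} (hr : 0 ≤ r) (hrs : r ≤ s) :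
    density p q a x r ≤ density p q a x s := by
  unfold density
  gcongr

theorem density_zero (hp : 0 < p) (hq : 0 < q) : density p q a x 0 = 0 := by
  simp [density, hp.ne', hq.ne']

theorem density_eq_add (ha : 0 ≤ a x) {r : ℝ} (hr : 0 ≤ r) :
    density p q a x r = ENNReal.ofReal (r ^ p) + ENNReal.ofReal (a x * r ^ q) :=
  ENNReal.ofReal_add (by positivity) (by positivity)

theorem continuous_density (hp : 0 < p) (hq : 0 < q) : Continuous (density p q a x) :=
  ENNReal.continuous_ofReal.comp ((Real.continuous_rpow_const hp.le).add
    (continuous_const.mul (Real.continuous_rpow_const hq.le)))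

theorem aemeasurable_density {F : Type*} [NormedAddCommGroup F] {μ : Measure (𝔼 n)}
    (ha : AEMeasurable a μ) {V : (𝔼 n) → F} (hV : AEStronglyMeasurable V μ) :
    AEMeasurable (fun x => density p q a x ‖V x‖) μ := by
  have := hV.norm.aemeasurable
  exact ((this.pow_const p).add (ha.mul (this.pow_const q))).ennreal_ofReal

/-- Convexity of the density, in a form that allows a factor near `1` on the first summand. -/
theorem density_add_le_weighted (hp : 1 < p) (hpq : p < q) (ha : 0 ≤ a x) {r s l : ℝ} (hr : 0 ≤ r)
    (hs : 0 ≤ s) (hl0 : 0 < l) (hl1 : l < 1) :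
    density p q a x (r + s) ≤ ENNReal.ofReal (l ^ (1 - q)) * density p q a x r +
      ENNReal.ofReal ((1 - l) ^ (1 - q)) * density p q a x s := by
  unfold density
  have hl1' : 0 < 1 - l := by linarith
  rw [← ENNReal.ofReal_mul (by positivity), ← ENNReal.ofReal_mul (by positivity),
    ← ENNReal.ofReal_add (by positivity) (by positivity)]
  refine ENNReal.ofReal_le_ofReal ?_
  have h1 := add_rpow_le_weighted hr hs hl0 hl1 hp.le
  have h2 := mul_le_mul_of_nonneg_left (add_rpow_le_weighted hr hs hl0 hl1 (hp.trans hpq).le) ha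
  have h3 : l ^ (1 - p) ≤ l ^ (1 - q) :=
    Real.rpow_le_rpow_of_exponent_ge hl0 hl1.le (by linarith)
  have h4 : (1 - l) ^ (1 - p) ≤ (1 - l) ^ (1 - q) :=
    Real.rpow_le_rpow_of_exponent_ge hl1' (by linarith) (by linarith)
  have h5 := mul_le_mul_of_nonneg_right h3 (Real.rpow_nonneg hr p)
  have h6 := mul_le_mul_of_nonneg_right h4 (Real.rpow_nonneg hs p)
  linarith

theorem density_add_le (hp : 1 < p) (hpq : p < q) (ha : 0 ≤ a x) {r s : ℝ} (hr : 0 ≤ r)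
    (hs : 0 ≤ s) :
    density p q a x (r + s) ≤
      ENNReal.ofReal (2 ^ (q - 1)) * (density p q a x r + density p q a x s) := by
  have := density_add_le_weighted hp hpq ha hr hs (l := 1 / 2) (by norm_num) (by norm_num)
  have e : (1 / 2 : ℝ) ^ (1 - q) = 2 ^ (q - 1) := by
    rw [one_div, Real.inv_rpow (by norm_num), ← Real.rpow_neg (by norm_num), neg_sub]
  rw [show (1 : ℝ) - 1 / 2 = 1 / 2 by norm_num, e] at this
  rwa [mul_add]

theorem density_norm_add_le (hp : 1 < p) (hpq : p < q) (ha : 0 ≤ a x) {F : Type*}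
    [NormedAddCommGroup F] (V W : F) :
    density p q a x ‖V + W‖ ≤
      ENNReal.ofReal (2 ^ (q - 1)) * (density p q a x ‖V‖ + density p q a x ‖W‖) :=
  (density_mono (by linarith) (by linarith) ha (norm_nonneg _) (norm_add_le _ _)).trans
    (density_add_le hp hpq ha (norm_nonneg _) (norm_nonneg _))

theorem setLIntegral_density_add_le (hp : 1 < p) (hpq : p < q) (hΩ : MeasurableSet Ω)
    (ha : ∀ x ∈ Ω, 0 ≤ a x) (ham : AEMeasurable a (volume.restrict Ω)) {F : Type*}
    [NormedAddCommGroup F] {V W : (𝔼 n) → F} (hV : AEStronglyMeasurable V (volume.restrict Ω)) :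
    ∫⁻ x in Ω, density p q a x ‖V x + W x‖ ≤ ENNReal.ofReal (2 ^ (q - 1)) *
      ((∫⁻ x in Ω, density p q a x ‖V x‖) + ∫⁻ x in Ω, density p q a x ‖W x‖) := by
  rw [← lintegral_add_left' (aemeasurable_density ham hV),
    ← lintegral_const_mul' _ _ ENNReal.ofReal_ne_top]
  exact setLIntegral_mono' hΩ fun x hx => density_norm_add_le hp hpq (ha x hx) _ _

/-- A vector field is modularly approximable on `Ω` if gradients of functions in `C_c^∞(Ω)` come
arbitrarily close to it with respect to the double phase modular. -/
def ModApprox (p q : ℝ) (a : (𝔼 n) → ℝ) (Ω : Set (𝔼 n)) (G : (𝔼 n) → (𝔼 n)) : Prop :=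
  ∀ ε : ℝ≥0∞, 0 < ε → ∃ ψ ∈ testFunctions Ω, ∫⁻ x in Ω, density p q a x ‖G x - gradient ψ x‖ < ε

variable {G H : (𝔼 n) → (𝔼 n)}

theorem ModApprox.congr (h : ModApprox p q a Ω G) (hGH : G =ᵐ[volume.restrict Ω] H) :
    ModApprox p q a Ω H := fun ε hε => by
  obtain ⟨ψ, hψ, hlt⟩ := h ε hε
  refine ⟨ψ, hψ, lt_of_eq_of_lt (lintegral_congr_ae ?_) hlt⟩
  filter_upwards [hGH] with x hx
  rw [hx]

theorem modApprox_zero (hp : 0 < p) (hq : 0 < q) : ModApprox p q a Ω 0 := fun ε hε =>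
  ⟨_, testFunctions.zero_mem, by simpa [density_zero hp hq] using hε⟩

theorem ModApprox.of_approx (hp : 1 < p) (hpq : p < q) (hΩ : MeasurableSet Ω)
    (ha : ∀ x ∈ Ω, 0 ≤ a x) (ham : AEMeasurable a (volume.restrict Ω))
    (hG : AEStronglyMeasurable G (volume.restrict Ω))
    (h : ∀ ε : ℝ≥0∞, 0 < ε → ∃ H, AEStronglyMeasurable H (volume.restrict Ω) ∧
      ModApprox p q a Ω H ∧ ∫⁻ x in Ω, density p q a x ‖G x - H x‖ < ε) :
    ModApprox p q a Ω G := fun ε hε => by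
  set c := ENNReal.ofReal (2 ^ (q - 1)) with hc
  have hc0 : c ≠ 0 := by simp only [hc, ne_eq, ENNReal.ofReal_eq_zero, not_le]; positivity
  have hc1 : c ≠ ⊤ := ENNReal.ofReal_ne_top
  have hε' : 0 < ε / c / 2 := ENNReal.half_pos (ENNReal.div_pos hε.ne' hc1).ne'
  obtain ⟨H, hH, hmod, hlt⟩ := h _ hε'
  obtain ⟨ψ, hψ, hlt'⟩ := hmod _ hε'
  refine ⟨ψ, hψ, ?_⟩
  have := setLIntegral_density_add_le hp hpq hΩ ha ham (V := fun x => G x - H x)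
    (W := fun x => H x - gradient ψ x) (hG.sub hH)
  simp only [sub_add_sub_cancel] at this
  refine this.trans_lt ?_
  calc _ < c * (ε / c) := by
        refine (ENNReal.mul_lt_mul_iff_right hc0 hc1).2 ?_
        exact (ENNReal.add_lt_add hlt hlt').trans_eq (ENNReal.add_halves _)
    _ ≤ ε := ENNReal.mul_div_le

theorem ModApprox.add (hp : 1 < p) (hpq : p < q) (hΩ : MeasurableSet Ω)
    (ha : ∀ x ∈ Ω, 0 ≤ a x) (ham : AEMeasurable a (volume.restrict Ω))
    (hG : AEStronglyMeasurable G (volume.restrict Ω)) (hGm : ModApprox p q a Ω G)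
    (hHm : ModApprox p q a Ω H) : ModApprox p q a Ω (G + H) := fun ε hε => by
  set c := ENNReal.ofReal (2 ^ (q - 1)) with hc
  have hc0 : c ≠ 0 := by simp only [hc, ne_eq, ENNReal.ofReal_eq_zero, not_le]; positivity
  have hc1 : c ≠ ⊤ := ENNReal.ofReal_ne_top
  have hε' : 0 < ε / c / 2 := ENNReal.half_pos (ENNReal.div_pos hε.ne' hc1).ne'
  obtain ⟨φ, hφ, hlt⟩ := hGm _ hε'
  obtain ⟨ψ, hψ, hlt'⟩ := hHm _ hε'
  refine ⟨_, testFunctions.add_mem hφ hψ, ?_⟩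
  have := setLIntegral_density_add_le hp hpq hΩ ha ham (V := fun x => G x - gradient φ x)
    (W := fun x => H x - gradient ψ x)
    (hG.sub (testFunctions.continuous_gradient hφ).aestronglyMeasurable)
  refine lt_of_le_of_lt (le_of_eq ?_) (this.trans_lt ?_)
  · refine lintegral_congr fun x => ?_
    rw [gradient_fun_add (testFunctions.differentiable hφ x) (testFunctions.differentiable hψ x),
      Pi.add_apply, add_sub_add_comm]
  calc _ < c * (ε / c) := by
        refine (ENNReal.mul_lt_mul_iff_right hc0 hc1).2 ?_
        exact (ENNReal.add_lt_add hlt hlt').trans_eq (ENNReal.add_halves _)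
    _ ≤ ε := ENNReal.mul_div_le

theorem ModApprox.sum (hp : 1 < p) (hpq : p < q) (hΩ : MeasurableSet Ω)
    (ha : ∀ x ∈ Ω, 0 ≤ a x) (ham : AEMeasurable a (volume.restrict Ω)) {ι : Type*} (s : Finset ι)
    {V : ι → (𝔼 n) → (𝔼 n)} (hV : ∀ i ∈ s, AEStronglyMeasurable (V i) (volume.restrict Ω))
    (hVm : ∀ i ∈ s, ModApprox p q a Ω (V i)) : ModApprox p q a Ω (∑ i ∈ s, V i) := by
  classical
  induction s using Finset.induction_on with
  | empty => simpa using modApprox_zero (by linarith) (by linarith)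
  | insert i s hi ih =>
    rw [Finset.sum_insert hi]
    refine .add hp hpq hΩ ha ham (hV i (by simp)) (hVm i (by simp)) (ih ?_ ?_)
    · exact fun j hj => hV j (by simp [hj])
    · exact fun j hj => hVm j (by simp [hj])

/-- In the energy of a field `H + G` with modularly approximable `G`, the summand `G` may be replaced
by gradients of test functions without raising the infimum. -/
theorem ModApprox.iInf_le (hp : 1 < p) (hpq : p < q) (hΩ : MeasurableSet Ω)
    (ha : ∀ x ∈ Ω, 0 ≤ a x) (ham : AEMeasurable a (volume.restrict Ω))
    (hG : AEStronglyMeasurable G (volume.restrict Ω)) (hGm : ModApprox p q a Ω G)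
    (hH : AEStronglyMeasurable H (volume.restrict Ω)) :
    ⨅ ψ ∈ testFunctions Ω, ∫⁻ x in Ω, density p q a x ‖H x + gradient ψ x‖ ≤
      ∫⁻ x in Ω, density p q a x ‖H x + G x‖ := by
  -- the inequality holds up to the factor `l ^ (1 - q)` for every `l < 1`
  have key : ∀ l : ℝ, 0 < l → l < 1 →
      ⨅ ψ ∈ testFunctions Ω, ∫⁻ x in Ω, density p q a x ‖H x + gradient ψ x‖ ≤
      ENNReal.ofReal (l ^ (1 - q)) * ∫⁻ x in Ω, density p q a x ‖H x + G x‖ := by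
    intro l hl0 hl1
    refine ENNReal.le_of_forall_pos_le_add fun ε hε _ => ?_
    set c := ENNReal.ofReal ((1 - l) ^ (1 - q)) with hc
    have hc1 : c ≠ ⊤ := ENNReal.ofReal_ne_top
    obtain ⟨ψ, hψ, hlt⟩ := hGm (ε / c) (ENNReal.div_pos (by simpa using hε.ne') hc1)
    refine (iInf₂_le ψ hψ).trans ?_
    calc _ ≤ ∫⁻ x in Ω, (ENNReal.ofReal (l ^ (1 - q)) * density p q a x ‖H x + G x‖ +
            c * density p q a x ‖G x - gradient ψ x‖) := by
          refine setLIntegral_mono' hΩ fun x hx => ?_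
          refine (density_mono (by linarith) (by linarith) (ha x hx) (norm_nonneg _) ?_).trans
            (density_add_le_weighted hp hpq (ha x hx) (norm_nonneg (H x + G x))
              (norm_nonneg (G x - gradient ψ x)) hl0 hl1)
          refine le_of_eq_of_le ?_ (norm_sub_le (H x + G x) (G x - gradient ψ x))
          congr 1
          abel
      _ ≤ _ := by
          have hm : AEMeasurable (fun x => density p q a x ‖H x + G x‖) (volume.restrict Ω) :=
            aemeasurable_density ham (hH.add hG)
          rw [lintegral_add_left' (hm.const_mul _),
            lintegral_const_mul' _ _ ENNReal.ofReal_ne_top, lintegral_const_mul' _ _ hc1]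
          gcongr
          calc _ ≤ c * (ε / c) := by gcongr
            _ ≤ ε := ENNReal.mul_div_le
  have hlim : Tendsto (fun l : ℝ => ENNReal.ofReal (l ^ (1 - q)) *
      ∫⁻ x in Ω, density p q a x ‖H x + G x‖) (𝓝[<] 1)
      (𝓝 (1 * ∫⁻ x in Ω, density p q a x ‖H x + G x‖)) := by
    refine ENNReal.Tendsto.mul_const ?_ (Or.inl one_ne_zero)
    have : Tendsto (fun l : ℝ => l ^ (1 - q)) (𝓝[<] 1) (𝓝 1) := by
      have h1 := (Real.continuousAt_rpow_const 1 (1 - q) (Or.inl one_ne_zero)).tendsto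
      rw [Real.one_rpow] at h1
      exact h1.mono_left nhdsWithin_le_nhds
    simpa using ENNReal.tendsto_ofReal this
  rw [one_mul] at hlim
  refine ge_of_tendsto hlim ?_
  filter_upwards [self_mem_nhdsWithin, mem_nhdsWithin_of_mem_nhds (lt_mem_nhds one_pos)] with l h1 h2
    using key l h2 h1
end

/-! ### Mollification with an off-centre kernel -/

/-- Continuity of translations in `L¹`. -/
theorem tendsto_lintegral_translate_sub {F : Type*} [NormedAddCommGroup F] {h : (𝔼 n) → F}
    (hh : Integrable h) :
    Tendsto (fun y => ∫⁻ x, ‖h (x - y) - h x‖ₑ) (𝓝 0) (𝓝 0) := by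
  let g : (𝔼 n) → C(𝔼 n, 𝔼 n) := fun y => ⟨fun x => x - y, by fun_prop⟩
  have hg : Continuous g :=
    ContinuousMap.continuous_of_continuous_uncurry _ (by
      change Continuous fun z : (𝔼 n) × (𝔼 n) => z.2 - z.1
      fun_prop)
  have hgm : ∀ y, MeasurePreserving (g y) volume volume := fun y =>
    measurePreserving_sub_right volume y
  have hc : Continuous fun y => Lp.compMeasurePreserving (g y) (hgm y) (hh.toL1 h) :=
    Continuous.compMeasurePreservingLp continuous_const hg hgm ENNReal.one_ne_top
  have h0 := (tendsto_iff_edist_tendsto_0.1 (hc.tendsto 0))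
  refine h0.congr fun y => ?_
  rw [Lp.edist_def, eLpNorm_one_eq_lintegral_enorm]
  refine lintegral_congr_ae ?_
  have hae : ∀ z, Lp.compMeasurePreserving (g z) (hgm z) (hh.toL1 h) =ᵐ[volume]
      fun x => h (x - z) := fun z =>
    (Lp.coeFn_compMeasurePreserving _ (hgm z)).trans
      ((hgm z).quasiMeasurePreserving.ae_eq_comp hh.coeFn_toL1)
  filter_upwards [hae y, hae 0] with x h1 h2
  rw [Pi.sub_apply, h1, h2, sub_zero]

/-- A mollification kernel: a smooth probability density supported in `closedBall v δ`. -/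
structure IsKernel (k : (𝔼 n) → ℝ) (v : 𝔼 n) (δ : ℝ) : Prop where
  contDiff : ContDiff ℝ ∞ k
  nonneg : ∀ y, 0 ≤ k y
  integral_eq_one : ∫ y, k y = 1
  mem_closedBall : ∀ y, k y ≠ 0 → y ∈ closedBall v δ

theorem exists_isKernel (v : 𝔼 n) {δ : ℝ} (hδ : 0 < δ) : ∃ k : (𝔼 n) → ℝ, IsKernel k v δ := by
  let f : ContDiffBump v := ⟨δ / 2, δ, by positivity, by linarith⟩
  refine ⟨f.normed volume, f.contDiff_normed, f.nonneg_normed, f.integral_normed, fun y hy => ?_⟩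
  have : y ∈ Function.support (f.normed volume) := hy
  rw [f.support_normed_eq] at this
  exact ball_subset_closedBall this

/-- The rescaled function `w ↦ t⁻ⁿ k(w / t)`. -/
def dilate (k : (𝔼 n) → ℝ) (t : ℝ) (w : 𝔼 n) : ℝ := (t ^ n)⁻¹ * k (t⁻¹ • w)

section Kernel
variable {k : (𝔼 n) → ℝ} {v : 𝔼 n} {δ t : ℝ}

theorem IsKernel.dilate (hk : IsKernel k v δ) (ht : 0 < t) :
    IsKernel (dilate k t) (t • v) (t * δ) where
  contDiff := contDiff_const.mul (hk.contDiff.comp (contDiff_const_smul _))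
  nonneg y := mul_nonneg (by positivity) (hk.nonneg _)
  integral_eq_one := by
    simp only [DoublePhase.dilate]
    rw [integral_const_mul, Measure.integral_comp_smul, hk.integral_eq_one, finrank_euclideanSpace,
      Fintype.card_fin]
    rw [abs_of_nonneg (by positivity)]
    simp [ht.ne']
  mem_closedBall y hy := by
    have h1 := hk.mem_closedBall (t⁻¹ • y) (right_ne_zero_of_mul hy)
    rw [Metric.mem_closedBall, dist_eq_norm] at h1 ⊢
    have : y - t • v = t • (t⁻¹ • y - v) := by
      rw [smul_sub, smul_smul, mul_inv_cancel₀ ht.ne', one_smul]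
    rw [this, norm_smul, Real.norm_of_nonneg ht.le]
    gcongr

theorem IsKernel.hasCompactSupport (hk : IsKernel k v δ) : HasCompactSupport k :=
  HasCompactSupport.intro (isCompact_closedBall v δ) fun y hy => by
    by_contra h
    exact hy (hk.mem_closedBall y h)

theorem IsKernel.mem_testFunctions (hk : IsKernel k v δ) : k ∈ testFunctions univ :=
  ⟨hk.contDiff, hk.hasCompactSupport, subset_univ _⟩

theorem IsKernel.norm_le (hk : IsKernel k v δ) {y : 𝔼 n} (hy : k y ≠ 0) : ‖y‖ ≤ ‖v‖ + δ := by
  have := hk.mem_closedBall y hy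
  rw [Metric.mem_closedBall, dist_eq_norm] at this
  linarith [norm_le_norm_add_norm_sub' y v]

theorem IsKernel.lintegral_eq_one (hk : IsKernel k v δ) : ∫⁻ y, ENNReal.ofReal (k y) = 1 := by
  rw [← ofReal_integral_eq_lintegral_ofReal (testFunctions.integrable hk.mem_testFunctions)
    (.of_forall hk.nonneg), hk.integral_eq_one, ENNReal.ofReal_one]

theorem IsKernel.measurable (hk : IsKernel k v δ) : Measurable fun y => ENNReal.ofReal (k y) :=
  hk.contDiff.continuous.measurable.ennreal_ofReal

theorem IsKernel.integral_norm_gradient_dilate (hk : IsKernel k v δ) (ht : 0 < t) :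
    ∫ y, ‖gradient (DoublePhase.dilate k t) y‖ = t⁻¹ * ∫ y, ‖gradient k y‖ := by
  have hg : ∀ y, ‖gradient (DoublePhase.dilate k t) y‖ =
      ((t ^ n)⁻¹ * t⁻¹) * ‖gradient k (t⁻¹ • y)‖ := fun y => by
    have hd : Differentiable ℝ k := hk.contDiff.differentiable (by simp)
    have hdt : DifferentiableAt ℝ (fun y => k (t⁻¹ • y)) y :=
      (hd _).comp y (differentiableAt_id.const_smul t⁻¹)
    have e : DoublePhase.dilate k t = fun y => (t ^ n)⁻¹ * k (t⁻¹ • y) := rfl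
    rw [e, gradient_fun_const_mul _ hdt, norm_smul, norm_gradient, norm_gradient,
      fderiv_comp_smul, norm_smul, Real.norm_of_nonneg (by positivity),
      Real.norm_of_nonneg (by positivity), mul_assoc]
  simp only [hg]
  rw [integral_const_mul, Measure.integral_comp_smul (μ := volume) (fun y => ‖gradient k y‖) t⁻¹,
    finrank_euclideanSpace, Fintype.card_fin, abs_of_nonneg (by positivity), smul_eq_mul, inv_pow,
    inv_inv]
  field_simp

/-- Jensen's inequality for averages with respect to a kernel. -/
theorem IsKernel.jensen (hk : IsKernel k v δ) {F : Type*} [NormedAddCommGroup F] [NormedSpace ℝ F]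
    {V : (𝔼 n) → F} (hV : AEStronglyMeasurable V volume) {s : ℝ} (hs : 1 ≤ s) :
    ENNReal.ofReal (‖∫ y, k y • V y‖ ^ s) ≤
      ∫⁻ y, ENNReal.ofReal (k y) * ENNReal.ofReal (‖V y‖ ^ s) := by
  have hs0 : 0 < s := by linarith
  set P : Measure (𝔼 n) := volume.withDensity fun y => ENNReal.ofReal (k y) with hP
  have : IsProbabilityMeasure P := ⟨by
    rw [hP, withDensity_apply _ MeasurableSet.univ, setLIntegral_univ, hk.lintegral_eq_one]⟩
  have hVP : AEStronglyMeasurable V P := hV.mono_ac (withDensity_absolutelyContinuous _ _)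
  have h1 : ‖∫ y, k y • V y‖ₑ ≤ ∫⁻ y, ‖V y‖ₑ ∂P := by
    rw [hP, lintegral_withDensity_eq_lintegral_mul₀ hk.measurable.aemeasurable hV.enorm]
    refine (enorm_integral_le_lintegral_enorm _).trans (le_of_eq (lintegral_congr fun y => ?_))
    rw [enorm_smul, Real.enorm_of_nonneg (hk.nonneg y), Pi.mul_apply]
  have h2 := eLpNorm'_le_eLpNorm'_of_exponent_le one_pos hs P hVP
  rw [eLpNorm'_eq_lintegral_enorm, eLpNorm'_eq_lintegral_enorm] at h2
  simp only [ENNReal.rpow_one, div_one] at h2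
  have h3 := ENNReal.rpow_le_rpow (h1.trans h2) hs0.le
  rw [← ENNReal.rpow_mul, one_div_mul_cancel hs0.ne', ENNReal.rpow_one, hP,
    lintegral_withDensity_eq_lintegral_mul₀ hk.measurable.aemeasurable (hV.enorm.pow_const s)] at h3
  rw [← ENNReal.ofReal_rpow_of_nonneg (norm_nonneg _) hs0.le, ofReal_norm]
  refine h3.trans (le_of_eq (lintegral_congr fun y => ?_))
  rw [Pi.mul_apply, ← ENNReal.ofReal_rpow_of_nonneg (norm_nonneg _) hs0.le, ofReal_norm]

/-- The mean oscillation of `h` at `x` with respect to the kernel `k`. -/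
def meanOsc {F : Type*} [NormedAddCommGroup F] (k : (𝔼 n) → ℝ) (h : (𝔼 n) → F) (x : 𝔼 n) : ℝ≥0∞ :=
  ∫⁻ y, ENNReal.ofReal (k y) * ‖h (x - y) - h x‖ₑ

theorem aemeasurable_meanOsc_integrand {F : Type*} [NormedAddCommGroup F] (hk : IsKernel k v δ)
    {h : (𝔼 n) → F} (hh : AEStronglyMeasurable h volume) :
    AEMeasurable (Function.uncurry fun x y => ENNReal.ofReal (k y) * ‖h (x - y) - h x‖ₑ)
      (volume.prod volume) := by
  have h1 : AEStronglyMeasurable (fun z : (𝔼 n) × (𝔼 n) => h (z.1 - z.2))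
      (volume.prod volume) :=
    hh.comp_quasiMeasurePreserving (quasiMeasurePreserving_sub volume volume)
  have h2 : AEStronglyMeasurable (fun z : (𝔼 n) × (𝔼 n) => h z.1) (volume.prod volume) :=
    hh.comp_quasiMeasurePreserving Measure.quasiMeasurePreserving_fst
  exact (hk.measurable.comp measurable_snd).aemeasurable.mul (h1.sub h2).enorm

theorem tendsto_lintegral_meanOsc {F : Type*} [NormedAddCommGroup F] (hk : IsKernel k v δ)
    {h : (𝔼 n) → F} (hh : Integrable h) :
    Tendsto (fun t => ∫⁻ x, meanOsc (DoublePhase.dilate k t) h x) (𝓝[>] 0) (𝓝 0) := by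
  rw [ENNReal.tendsto_nhds_zero]
  intro ε hε
  have h1 := ENNReal.tendsto_nhds_zero.1 (tendsto_lintegral_translate_sub hh) ε hε
  obtain ⟨ρ, hρ, hball⟩ := Metric.eventually_nhds_iff_ball.1 h1
  set R := |‖v‖ + δ| + 1 with hR
  have hRpos : 0 < R := by positivity
  filter_upwards [self_mem_nhdsWithin, mem_nhdsWithin_of_mem_nhds (gt_mem_nhds
    (show (0 : ℝ) < ρ / R by positivity))] with t ht htρ
  have ht : 0 < t := ht
  have hkt := hk.dilate ht
  unfold meanOsc
  rw [lintegral_lintegral_swap (aemeasurable_meanOsc_integrand hkt hh.1)]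
  calc _ ≤ ∫⁻ y, ENNReal.ofReal (DoublePhase.dilate k t y) * ε := by
        refine lintegral_mono fun y => ?_
        rw [lintegral_const_mul' _ _ ENNReal.ofReal_ne_top]
        by_cases hy : DoublePhase.dilate k t y = 0
        · simp [hy]
        · gcongr
          refine hball y ?_
          rw [mem_ball_zero_iff]
          have h2 := hkt.norm_le hy
          rw [norm_smul, Real.norm_of_nonneg ht.le, ← mul_add] at h2
          rw [lt_div_iff₀ hRpos] at htρ
          refine h2.trans_lt (lt_of_le_of_lt ?_ htρ)
          have := le_abs_self (‖v‖ + δ)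
          gcongr
          linarith
    _ = ε := by
        rw [lintegral_mul_const _ hkt.measurable, hkt.lintegral_eq_one, one_mul]

theorem IsKernel.enorm_integral_sub_le (hk : IsKernel k v δ) {F : Type*} [NormedAddCommGroup F]
    [NormedSpace ℝ F] [CompleteSpace F] {h : (𝔼 n) → F} (hh : Integrable h) (x : 𝔼 n) :
    ‖h x - ∫ y, k y • h (x - y)‖ₑ ≤ meanOsc k h x := by
  have hi : Integrable fun y => k y • h (x - y) := by
    obtain ⟨C, hC, hb⟩ := testFunctions.exists_bound hk.mem_testFunctions
    exact (hh.comp_sub_left x).bdd_smul C hk.contDiff.continuous.aestronglyMeasurable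
      (.of_forall fun y => (hb y).1)
  have hi' : Integrable fun y => k y • h x :=
    (testFunctions.integrable hk.mem_testFunctions).smul_const _
  have e : ∫ y, k y • h x = h x := by rw [integral_smul_const, hk.integral_eq_one, one_smul]
  rw [enorm_sub_rev]
  have e' : (∫ y, k y • h (x - y)) - h x = ∫ y, (k y • h (x - y) - k y • h x) := by
    rw [integral_sub hi hi', e]
  rw [e']
  refine (enorm_integral_le_lintegral_enorm _).trans (le_of_eq (lintegral_congr fun y => ?_))
  rw [← smul_sub, enorm_smul, Real.enorm_of_nonneg (hk.nonneg y)]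

end Kernel

/-- The convolution of `u` with the kernel `k`. -/
def mollify (k u : (𝔼 n) → ℝ) (x : 𝔼 n) : ℝ := ∫ y, k y • u (x - y)

section Mollify
variable {k u : (𝔼 n) → ℝ} {G : (𝔼 n) → (𝔼 n)} {v : 𝔼 n} {δ : ℝ} {Ω : Set (𝔼 n)}

theorem mollify_eq_convolution (k u : (𝔼 n) → ℝ) :
    mollify k u = convolution k u (ContinuousLinearMap.lsmul ℝ ℝ) volume := rfl

theorem IsKernel.contDiff_mollify (hk : IsKernel k v δ) (hu : Integrable u) :
    ContDiff ℝ ∞ (mollify k u) := by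
  rw [mollify_eq_convolution]
  exact hk.hasCompactSupport.contDiff_convolution_left _ hk.contDiff hu.locallyIntegrable

theorem IsKernel.gradient_mollify (hk : IsKernel k v δ) (hu : Integrable u) (x : 𝔼 n) :
    gradient (mollify k u) x = ∫ y, u (x - y) • gradient k y := by
  have hk1 : ContDiff ℝ 1 k := by simpa using testFunctions.contDiff hk.mem_testFunctions 1
  have h1 := hk.hasCompactSupport.hasFDerivAt_convolution_left (ContinuousLinearMap.lsmul ℝ ℝ)
    hk1 hu.locallyIntegrable x
  have hi : Integrable fun y => u (x - y) • gradient k y := by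
    obtain ⟨C, hC, hb⟩ := testFunctions.exists_bound hk.mem_testFunctions
    exact (hu.comp_sub_left x).smul_bdd C
      (testFunctions.continuous_gradient hk.mem_testFunctions).aestronglyMeasurable
      (.of_forall fun y => (hb y).2)
  refine ext_inner_right ℝ fun w => ?_
  rw [inner_gradient, mollify_eq_convolution, h1.fderiv, real_inner_comm, ← integral_inner hi]
  have hex := (hk.hasCompactSupport.fderiv ℝ).convolutionExists_left
    ((ContinuousLinearMap.lsmul ℝ ℝ).precompL (𝔼 n)) (hk1.continuous_fderiv one_ne_zero)
    hu.locallyIntegrable x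
  rw [convolution_def, ContinuousLinearMap.integral_apply hex]
  refine integral_congr_ae (.of_forall fun y => ?_)
  simp only
  rw [inner_smul_right, real_inner_comm, inner_gradient]
  simp [ContinuousLinearMap.precompL_apply, mul_comm]

theorem IsKernel.norm_gradient_mollify_le (hk : IsKernel k v δ) (hu : Integrable u) {M : ℝ}
    (hM : ∀ x, |u x| ≤ M) (x : 𝔼 n) :
    ‖gradient (mollify k u) x‖ ≤ M * ∫ y, ‖gradient k y‖ := by
  rw [hk.gradient_mollify hu, ← integral_const_mul]
  refine norm_integral_le_of_norm_le
    ((testFunctions.integrable_gradient hk.mem_testFunctions).norm.const_mul _)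
    (.of_forall fun y => ?_)
  rw [norm_smul]
  gcongr
  exact hM _

/-- Mollification commutes with the weak gradient. -/
theorem HasGradZero.gradient_mollify (h : HasGradZero Ω u G) (hk : IsKernel k v δ) (x : 𝔼 n) :
    gradient (mollify k u) x = ∫ y, k y • G (x - y) := by
  rw [hk.gradient_mollify h.integrable, ← integral_sub_left_eq_self _ volume x,
    ← integral_sub_left_eq_self (fun y => k y • G (x - y)) volume x]
  simp only [sub_sub_cancel]
  have hφ : (fun z => k (x - z)) ∈ testFunctions univ :=
    ⟨hk.contDiff.comp (contDiff_const.sub contDiff_id),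
      hk.hasCompactSupport.comp_homeomorph (Homeomorph.subLeft x), subset_univ _⟩
  have h1 := (h.hasWeakGradient univ).integral_eq _ hφ
  simp only [setIntegral_univ] at h1
  have hg : ∀ z, gradient (fun z => k (x - z)) z = - gradient k (x - z) := fun z => by
    refine ext_inner_right ℝ fun w => ?_
    have hd : HasFDerivAt k (fderiv ℝ k (x - z)) (x - z) :=
      (testFunctions.differentiable hk.mem_testFunctions _).hasFDerivAt
    have := (hd.comp z ((hasFDerivAt_id z).const_sub x)).fderiv
    have e : fderiv ℝ (fun z => k (x - z)) z = _ := this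
    rw [inner_neg_left, inner_gradient, inner_gradient, e]
    simp
  simp only [hg, smul_neg, integral_neg, neg_inj] at h1
  exact h1

theorem IsKernel.mollify_mem_testFunctions (hk : IsKernel k v δ) (hu : Integrable u)
    (hΩ : Bornology.IsBounded Ω) {δ' : ℝ} (hδ : δ < δ') {S : Set (𝔼 n)}
    (hS : ∀ z, u z ≠ 0 → z ∈ S) (h : ∀ z ∈ S, ∀ y ∈ closedBall v δ', z + y ∈ Ω) :
    mollify k u ∈ testFunctions Ω := by
  have hsub : tsupport (mollify k u) ⊆ Ω := by
    intro w hw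
    obtain ⟨w', hw', hd⟩ := Metric.mem_closure_iff.1 hw (δ' - δ) (by linarith)
    have : ∃ y, k y • u (w' - y) ≠ 0 := by
      by_contra! hc
      exact hw' (by simp only [mollify, hc, integral_zero])
    obtain ⟨y, hy⟩ := this
    have h1 := hk.mem_closedBall y (left_ne_zero_of_smul hy)
    have h2 := h _ (hS _ (right_ne_zero_of_smul hy)) (y + (w - w')) (by
      rw [Metric.mem_closedBall, dist_eq_norm] at h1 ⊢
      rw [dist_eq_norm] at hd
      have : y + (w - w') - v = (y - v) + (w - w') := by abel
      rw [this]
      linarith [norm_add_le (y - v) (w - w')])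
    have e : w' - y + (y + (w - w')) = w := by abel
    rwa [e] at h2
  exact ⟨hk.contDiff_mollify hu,
    Metric.isCompact_of_isClosed_isBounded (isClosed_tsupport _) (hΩ.subset hsub), hsub⟩

end Mollify

/-! ### Modular convergence of the mollification -/

section Local
variable {p q κ : ℝ} {a u : (𝔼 n) → ℝ} {G : (𝔼 n) → (𝔼 n)} {Ω : Set (𝔼 n)} {k : (𝔼 n) → ℝ}
  {v x : 𝔼 n} {δ : ℝ}

/-- The averaged field has double phase density at most a constant times the average of the double
phase density. Either `a x` is small compared with the `κ`-th power of the size of the kernel, and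
the bound `B` on the averaged field turns the exponent `q` into `p`; or `a x` is comparable with
the values of `a` at all points of the support. -/
theorem density_average_le (hp : 1 < p) (hpq : p < q) (hκ : 0 < κ) {C : ℝ} (hC : 0 < C)
    (ha : ∀ x ∈ Ω, 0 ≤ a x) (haC : ∀ x ∈ Ω, ∀ y ∈ Ω, a x ≤ C * (a y + ‖x - y‖ ^ κ))
    (hk : IsKernel k v δ) (hG : AEStronglyMeasurable G volume) (hG0 : ∀ x ∉ Ω, G x = 0)
    {r B A : ℝ} (hr : ∀ y, k y ≠ 0 → ‖y‖ ≤ r) (hr0 : 0 ≤ r) (hx : x ∈ Ω)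
    (hB : ‖∫ y, k y • G (x - y)‖ ≤ B) (hA : r ^ κ * B ^ (q - p) ≤ A) :
    density p q a x ‖∫ y, k y • G (x - y)‖ ≤ ENNReal.ofReal (1 + 2 * C * A + 2 * C) *
      ∫⁻ y, ENNReal.ofReal (k y) * Ω.indicator (fun z => density p q a z ‖G z‖) (x - y) := by
  have hp0 : 0 < p := by linarith
  have hq0 : 0 < q := by linarith
  set N := ‖∫ y, k y • G (x - y)‖ with hN
  set I := ∫⁻ y, ENNReal.ofReal (k y) * Ω.indicator (fun z => density p q a z ‖G z‖) (x - y)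
    with hI
  have hN0 : 0 ≤ N := norm_nonneg _
  have hB0 : 0 ≤ B := hN0.trans hB
  have hA0 : 0 ≤ A := le_trans (by positivity) hA
  have hGx : AEStronglyMeasurable (fun y => G (x - y)) volume :=
    hG.comp_measurePreserving (Measure.measurePreserving_sub_left volume x)
  have h1 : ENNReal.ofReal (N ^ p) ≤ I := by
    refine (hk.jensen hGx hp.le).trans (lintegral_mono fun y => ?_)
    dsimp only
    gcongr
    by_cases hy : x - y ∈ Ω
    · rw [indicator_of_mem hy, density_eq_add (ha _ hy) (norm_nonneg _)]
      exact le_self_add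
    · simp [hG0 _ hy, hp0.ne']
  have h2 : ENNReal.ofReal (a x * N ^ q) ≤ ENNReal.ofReal (2 * C * A + 2 * C) * I := by
    rw [ENNReal.ofReal_add (by positivity) (by positivity), add_mul]
    rcases le_or_gt (a x) (2 * C * r ^ κ) with hc | hc
    · refine le_trans ?_ le_self_add
      have e : N ^ q = N ^ (q - p) * N ^ p := by
        rw [← Real.rpow_add_of_nonneg hN0 (by linarith) hp0.le]
        congr 1
        ring
      have : a x * N ^ q ≤ 2 * C * A * N ^ p := by
        rw [e, ← mul_assoc]
        refine mul_le_mul_of_nonneg_right ?_ (by positivity)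
        calc a x * N ^ (q - p) ≤ (2 * C * r ^ κ) * B ^ (q - p) := by
              have := ha x hx
              gcongr
          _ = 2 * C * (r ^ κ * B ^ (q - p)) := by ring
          _ ≤ 2 * C * A := by gcongr
      refine (ENNReal.ofReal_le_ofReal this).trans ?_
      rw [ENNReal.ofReal_mul (by positivity)]
      gcongr
    · refine le_trans ?_ le_add_self
      have hj := hk.jensen hGx (hp.trans hpq).le
      rw [ENNReal.ofReal_mul (ha x hx), hI, ← lintegral_const_mul' _ _ ENNReal.ofReal_ne_top]
      refine (mul_le_mul_right hj _).trans ?_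
      rw [← lintegral_const_mul' _ _ ENNReal.ofReal_ne_top]
      refine lintegral_mono fun y => ?_
      dsimp only
      by_cases hky : k y = 0
      · simp [hky]
      by_cases hy : x - y ∈ Ω
      · have h3 := haC x hx _ hy
        rw [sub_sub_cancel] at h3
        have h4 : ‖y‖ ^ κ ≤ r ^ κ := Real.rpow_le_rpow (norm_nonneg _) (hr y hky) hκ.le
        have h5 : a x ≤ 2 * C * a (x - y) := by
          have := mul_le_mul_of_nonneg_left h4 hC.le
          linarith
        rw [indicator_of_mem hy, mul_left_comm, mul_left_comm (ENNReal.ofReal (2 * C))]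
        refine mul_le_mul_right ?_ _
        rw [← ENNReal.ofReal_mul (ha x hx), density, ← ENNReal.ofReal_mul (by positivity)]
        refine ENNReal.ofReal_le_ofReal ?_
        have h6 := mul_le_mul_of_nonneg_right h5 (Real.rpow_nonneg (norm_nonneg (G (x - y))) q)
        have h7 : 0 ≤ 2 * C * ‖G (x - y)‖ ^ p := by positivity
        linarith
      · simp [hG0 _ hy, hq0.ne']
  rw [density_eq_add (ha x hx) hN0, add_assoc, ENNReal.ofReal_add zero_le_one (by positivity),
    ENNReal.ofReal_one, add_mul, one_mul]
  exact add_le_add h1 h2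

/-- A Sobolev function with zero boundary values that is bounded and has finite energy, and whose
support can be moved into `Ω` by all short translations in an open cone of directions, is modularly
approximable: mollify it with a kernel supported in that cone. -/
theorem HasGradZero.modApprox_of_translate (hp : 1 < p) (hpq : p < q) (hκ : 0 < κ)
    (hqκ : q ≤ p + κ) (hΩ : IsOpen Ω) (hΩb : Bornology.IsBounded Ω)
    (ham : AEMeasurable a (volume.restrict Ω)) (haz : MemZ κ Ω a) (h : HasGradZero Ω u G) {M : ℝ}
    (hM : ∀ x, |u x| ≤ M) (hE : ∫⁻ x in Ω, density p q a x ‖G x‖ < ⊤) {t₀ : ℝ} (hδ : 0 < δ)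
    (ht₀ : 0 < t₀) {S : Set (𝔼 n)} (hS : ∀ z, u z ≠ 0 → z ∈ S)
    (hgeo : ∀ t, 0 < t → t < t₀ → ∀ z ∈ S, ∀ y ∈ closedBall v δ, z + t • y ∈ Ω) :
    ModApprox p q a Ω G := by
  intro ε hε
  obtain ⟨ha, C, hC, haC⟩ := haz
  have hp0 : 0 < p := by linarith
  have hq0 : 0 < q := by linarith
  have hM0 : 0 ≤ M := (abs_nonneg _).trans (hM 0)
  -- half the available radius leaves room for the closure of the support
  obtain ⟨k, hk⟩ := exists_isKernel v (half_pos hδ)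
  set b := ∫ y, ‖gradient k y‖ with hb
  have hb0 : 0 ≤ b := integral_nonneg fun _ => norm_nonneg _
  set R := ‖v‖ + δ with hR
  have hR0 : 0 < R := by positivity
  set A := R ^ κ * (M * b) ^ (q - p) with hA
  set K := 1 + 2 * C * A + 2 * C with hK
  have hA0 : 0 ≤ A := by positivity
  have hK0 : 0 < K := by positivity
  -- the scales stay below `1`, so that their nonnegative powers are at most `1`
  set t : ℕ → ℝ := fun j => min 1 t₀ / (j + 2) with ht
  have htpos : ∀ j, 0 < t j := fun j => by positivity
  have htlt : ∀ j, t j < min 1 t₀ := fun j => by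
    have : (0 : ℝ) < min 1 t₀ := by positivity
    rw [ht]
    simp only
    rw [div_lt_iff₀ (by positivity)]
    nlinarith [(Nat.cast_nonneg j : (0 : ℝ) ≤ j)]
  have htlim : Tendsto t atTop (𝓝[>] 0) := by
    refine tendsto_nhdsWithin_iff.2 ⟨?_, .of_forall htpos⟩
    have := (tendsto_const_div_atTop_nhds_zero_nat (min 1 t₀)).comp (tendsto_add_atTop_nat 2)
    refine this.congr fun j => ?_
    simp [ht]
  set kt : ℕ → (𝔼 n) → ℝ := fun j => dilate k (t j) with hkt
  have hkt' : ∀ j, IsKernel (kt j) (t j • v) (t j * (δ / 2)) := fun j => hk.dilate (htpos j)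
  set ψ : ℕ → (𝔼 n) → ℝ := fun j => mollify (kt j) u with hψ
  have hψt : ∀ j, ψ j ∈ testFunctions Ω := fun j => by
    refine (hkt' j).mollify_mem_testFunctions h.integrable hΩb (δ' := t j * δ) ?_ hS ?_
    · have := htpos j
      gcongr
      linarith
    · intro z hz y hy
      have := hgeo (t j) (htpos j) ((htlt j).trans_le (min_le_right _ _)) z hz ((t j)⁻¹ • y) (by
        rw [Metric.mem_closedBall, dist_eq_norm] at hy ⊢
        have e : (t j)⁻¹ • y - v = (t j)⁻¹ • (y - t j • v) := by
          rw [smul_sub, smul_smul, inv_mul_cancel₀ (htpos j).ne', one_smul]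
        rw [e, norm_smul, Real.norm_of_nonneg (inv_nonneg.2 (htpos j).le),
          inv_mul_le_iff₀ (htpos j)]
        exact hy)
      rwa [smul_smul, mul_inv_cancel₀ (htpos j).ne', one_smul] at this
  have hψG : ∀ j x, gradient (ψ j) x = ∫ y, kt j y • G (x - y) := fun j x =>
    h.gradient_mollify (hkt' j) x
  -- `L¹` convergence of the gradients gives almost everywhere convergence along a subsequence
  have hL1 : Tendsto (fun j => ∫⁻ x, ‖G x - gradient (ψ j) x‖ₑ) atTop (𝓝 0) := by
    refine tendsto_of_tendsto_of_tendsto_of_le_of_le tendsto_const_nhds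
      ((tendsto_lintegral_meanOsc hk h.integrable_grad).comp htlim) (fun _ => zero_le) fun j => ?_
    refine lintegral_mono fun x => ?_
    rw [hψG]
    exact (hkt' j).enorm_integral_sub_le h.integrable_grad x
  obtain ⟨ns, hns, hae⟩ := exists_subseq_tendsto_ae
    (fun j => (testFunctions.continuous_gradient (hψt j)).aestronglyMeasurable) h.aesm_grad hL1
  -- the energy density of `G`, real-valued in order to measure its oscillation
  set e : (𝔼 n) → ℝ := Ω.indicator fun z => ‖G z‖ ^ p + a z * ‖G z‖ ^ q with he
  have he0 : ∀ z, 0 ≤ e z := fun z => by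
    refine indicator_nonneg (fun z hz => ?_) z
    have := ha z hz
    positivity
  have hed : ∀ z, Ω.indicator (fun z => density p q a z ‖G z‖) z = ENNReal.ofReal (e z) := by
    intro z
    by_cases hz : z ∈ Ω <;> simp [he, hz, density]
  have hem : AEMeasurable (fun z => ‖G z‖ ^ p + a z * ‖G z‖ ^ q) (volume.restrict Ω) :=
    (h.aesm_grad.norm.aemeasurable.restrict.pow_const p).add
      (ham.mul (h.aesm_grad.norm.aemeasurable.restrict.pow_const q))
  have hei : Integrable e := by
    rw [he, integrable_indicator_iff hΩ.measurableSet]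
    refine ⟨hem.aestronglyMeasurable, ?_⟩
    refine lt_of_eq_of_lt (setLIntegral_congr_fun hΩ.measurableSet fun x hx => ?_) hE
    have := ha x hx
    simp only [density]
    rw [Real.enorm_of_nonneg (by positivity)]
  have hosc := (tendsto_lintegral_meanOsc hk hei).comp htlim
  set c := ENNReal.ofReal (2 ^ (q - 1)) with hc
  set D := c * (1 + ENNReal.ofReal K) with hD
  have hDtop : D ≠ ⊤ := ENNReal.mul_ne_top ENNReal.ofReal_ne_top
    (ENNReal.add_ne_top.2 ⟨ENNReal.one_ne_top, ENNReal.ofReal_ne_top⟩)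
  -- the error is bounded by a fixed integrable function and a term tending to `0` in `L¹`
  have hbound : ∀ j, ∀ x ∈ Ω, density p q a x ‖G x - gradient (ψ j) x‖ ≤
      D * ENNReal.ofReal (e x) + D * meanOsc (kt j) e x := by
    intro j x hx
    have h1 : density p q a x ‖gradient (ψ j) x‖ ≤ ENNReal.ofReal K *
        ∫⁻ y, ENNReal.ofReal (kt j y) * ENNReal.ofReal (e (x - y)) := by
      have htj := htpos j
      have := density_average_le hp hpq hκ hC ha haC (hkt' j) h.aesm_grad h.grad_eq_zero
        (r := t j * R) (B := M * ((t j)⁻¹ * b)) (A := A) (fun y hy => ?_) (by positivity) hx ?_ ?_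
      · simp only [hed] at this
        rwa [← hψG] at this
      · refine ((hkt' j).norm_le hy).trans ?_
        rw [norm_smul, Real.norm_of_nonneg htj.le, ← mul_add]
        gcongr
        linarith
      · rw [← hψG, hb, ← hk.integral_norm_gradient_dilate htj]
        exact (hkt' j).norm_gradient_mollify_le h.integrable hM x
      · -- the powers of the scale combine to `t ^ (κ - (q - p)) ≤ 1`
        have e1 : M * ((t j)⁻¹ * b) = (t j)⁻¹ * (M * b) := by ring
        rw [e1, Real.mul_rpow htj.le hR0.le, Real.mul_rpow (by positivity) (by positivity),
          Real.inv_rpow htj.le, ← Real.rpow_neg htj.le]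
        have e2 : t j ^ κ * t j ^ (-(q - p)) ≤ 1 := by
          rw [← Real.rpow_add htj]
          exact Real.rpow_le_one htj.le ((htlt j).trans_le (min_le_left _ _)).le (by linarith)
        calc _ = (t j ^ κ * t j ^ (-(q - p))) * A := by rw [hA]; ring
          _ ≤ 1 * A := by gcongr
          _ = A := one_mul A
    have h2 : ∫⁻ y, ENNReal.ofReal (kt j y) * ENNReal.ofReal (e (x - y)) ≤
        ENNReal.ofReal (e x) + meanOsc (kt j) e x := by
      calc _ ≤ ∫⁻ y, (ENNReal.ofReal (kt j y) * ENNReal.ofReal (e x) +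
            ENNReal.ofReal (kt j y) * ‖e (x - y) - e x‖ₑ) := by
            refine lintegral_mono fun y => ?_
            simp only
            rw [← mul_add]
            gcongr
            rw [← ofReal_norm, ← ENNReal.ofReal_add (he0 x) (norm_nonneg _)]
            refine ENNReal.ofReal_le_ofReal ?_
            linarith [Real.le_norm_self (e (x - y) - e x)]
        _ = _ := by
            rw [lintegral_add_left ((hkt' j).measurable.mul_const _),
              lintegral_mul_const _ (hkt' j).measurable, (hkt' j).lintegral_eq_one, one_mul]
            rfl
    have h3 := density_norm_add_le hp hpq (ha x hx) (G x) (-gradient (ψ j) x)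
    rw [← sub_eq_add_neg, norm_neg] at h3
    have h4 : density p q a x ‖G x‖ = ENNReal.ofReal (e x) := by rw [← hed, indicator_of_mem hx]
    refine h3.trans ?_
    rw [← mul_add, hD, mul_assoc, h4]
    gcongr
    rw [add_mul, one_mul]
    exact add_le_add le_self_add (h1.trans (by gcongr))
  -- the error truncated at `D * e` has an integrable bound; what is cut off is at most `D * meanOsc`
  have hdct : Tendsto (fun j => ∫⁻ x in Ω, min (density p q a x ‖G x - gradient (ψ (ns j)) x‖)
      (D * ENNReal.ofReal (e x))) atTop (𝓝 0) := by
    have := tendsto_lintegral_of_dominated_convergence' (μ := volume.restrict Ω)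
      (F := fun j x => min (density p q a x ‖G x - gradient (ψ (ns j)) x‖)
        (D * ENNReal.ofReal (e x))) (f := fun _ => 0)
      (fun x => D * ENNReal.ofReal (e x)) (fun j => ?_) (fun j => .of_forall fun x => min_le_right _ _)
      ?_ ?_
    · simpa using this
    · exact (aemeasurable_density ham (h.aesm_grad.restrict.sub
        (testFunctions.continuous_gradient (hψt _)).aestronglyMeasurable)).min
        ((hei.1.aemeasurable.restrict.ennreal_ofReal).const_mul _)
    · rw [lintegral_const_mul' _ _ hDtop]
      refine ENNReal.mul_ne_top hDtop ((setLIntegral_le_lintegral _ _).trans_lt ?_).ne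
      exact (lintegral_ofReal_le_lintegral_enorm e).trans_lt hei.2
    · filter_upwards [ae_restrict_of_ae hae] with x hx
      have h1 : Tendsto (fun j => ‖G x - gradient (ψ (ns j)) x‖) atTop (𝓝 0) := by
        simpa using (tendsto_const_nhds (x := G x)).sub hx |>.norm
      have h2 := ((continuous_density (a := a) (x := x) hp0 hq0).tendsto 0).comp h1
      rw [density_zero hp0 hq0] at h2
      exact tendsto_of_tendsto_of_tendsto_of_le_of_le tendsto_const_nhds h2 (fun _ => zero_le)
        fun j => min_le_left _ _
  have hsum := hdct.add ((ENNReal.Tendsto.const_mul (hosc.comp hns.tendsto_atTop)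
    (Or.inr hDtop)))
  rw [mul_zero, add_zero] at hsum
  obtain ⟨j, hj⟩ := (hsum.eventually (gt_mem_nhds hε)).exists
  refine ⟨ψ (ns j), hψt _, lt_of_le_of_lt ?_ hj⟩
  have hmin : AEMeasurable (fun x => min (density p q a x ‖G x - gradient (ψ (ns j)) x‖)
      (D * ENNReal.ofReal (e x))) (volume.restrict Ω) :=
    (aemeasurable_density ham (h.aesm_grad.restrict.sub
        (testFunctions.continuous_gradient (hψt _)).aestronglyMeasurable)).min
        ((hei.1.aemeasurable.restrict.ennreal_ofReal).const_mul _)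
  calc _ ≤ ∫⁻ x in Ω, (min (density p q a x ‖G x - gradient (ψ (ns j)) x‖)
        (D * ENNReal.ofReal (e x)) + D * meanOsc (kt (ns j)) e x) := by
        refine setLIntegral_mono' hΩ.measurableSet fun x hx => ?_
        rcases le_total (density p q a x ‖G x - gradient (ψ (ns j)) x‖)
          (D * ENNReal.ofReal (e x)) with hle | hle
        · rw [min_eq_left hle]
          exact le_self_add
        · rw [min_eq_right hle]
          exact hbound _ x hx
    _ ≤ _ := by
        rw [lintegral_add_left' hmin, lintegral_const_mul' _ _ hDtop]
        gcongr
        exact setLIntegral_le_lintegral _ _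

end Local

/-! ### Inward translations in Lipschitz domains -/

/-- Near every point of its closure, a Lipschitz domain is mapped into itself by all short
translations in some open cone of directions. -/
theorem IsLipschitzDomain.exists_translate {Ω : Set (𝔼 n)} (hΩ : IsLipschitzDomain Ω) {x₀ : 𝔼 n}
    (hx₀ : x₀ ∈ closure Ω) :
    ∃ r : ℝ, 0 < r ∧ ∃ t₀ : ℝ, 0 < t₀ ∧ ∃ (v : 𝔼 n) (δ : ℝ), 0 < δ ∧
      ∀ t, 0 < t → t < t₀ → ∀ z ∈ Ω ∩ closedBall x₀ r, ∀ y ∈ closedBall v δ, z + t • y ∈ Ω := by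
  by_cases hx : x₀ ∈ Ω
  · obtain ⟨r, hr, hball⟩ := Metric.isOpen_iff.1 hΩ.isOpen x₀ hx
    refine ⟨r / 2, by positivity, r / 2, by positivity, 0, 1, one_pos, ?_⟩
    rintro t ht htr z ⟨-, hz⟩ y hy
    apply hball
    rw [Metric.mem_closedBall, dist_eq_norm] at hz
    rw [mem_closedBall_zero_iff] at hy
    rw [Metric.mem_ball, dist_eq_norm, add_sub_right_comm]
    refine (norm_add_le _ _).trans_lt ?_
    rw [norm_smul, Real.norm_of_nonneg ht.le]
    nlinarith [norm_nonneg y]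
  · have hxf : x₀ ∈ frontier Ω := by rw [hΩ.isOpen.frontier_eq]; exact ⟨hx₀, hx⟩
    obtain ⟨r, hr, e, he, K, g, hg, hepi⟩ := hΩ.local_epigraph x₀ hxf
    have hK : (0 : ℝ) ≤ K := K.2
    refine ⟨r / 4, by positivity, r / 4, by positivity, e, 1 / (2 * K + 1), by positivity, ?_⟩
    rintro t ht htr z ⟨hzΩ, hz⟩ y hy
    set δ : ℝ := 1 / (2 * K + 1) with hδ
    have hδ0 : 0 < δ := by positivity
    have hδK : 2 * K * δ + δ = 1 := by rw [hδ]; field_simp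
    have hδ1 : δ ≤ 1 := by nlinarith
    rw [Metric.mem_closedBall, dist_eq_norm] at hz hy
    have hzr : z ∈ ball x₀ r := by rw [Metric.mem_ball, dist_eq_norm]; linarith
    have hyn : ‖y‖ ≤ 1 + δ := by
      have := norm_le_norm_add_norm_sub' y e
      linarith
    have hwr : z + t • y ∈ ball x₀ r := by
      rw [Metric.mem_ball, dist_eq_norm, add_sub_right_comm]
      refine (norm_add_le _ _).trans_lt ?_
      rw [norm_smul, Real.norm_of_nonneg ht.le]
      nlinarith [norm_nonneg y]
    rw [hepi _ hwr]
    have hgz := (hepi z hzr).1 hzΩ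
    set d := y - e with hd
    have hyd : y = e + d := by rw [hd]; abel
    have hee : ⟪e, e⟫_ℝ = 1 := by rw [real_inner_self_eq_norm_sq, he]; norm_num
    have hed : |⟪e, d⟫_ℝ| ≤ δ := by
      refine (abs_real_inner_le_norm e d).trans ?_
      rw [he, one_mul]
      exact hy
    have hinner : ⟪e, z + t • y⟫_ℝ = ⟪e, z⟫_ℝ + t * (1 + ⟪e, d⟫_ℝ) := by
      rw [inner_add_right, inner_smul_right, hyd, inner_add_right, hee]
    have hdiff : (z + t • y - ⟪e, z + t • y⟫_ℝ • e) - (z - ⟪e, z⟫_ℝ • e) =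
        t • (d - ⟪e, d⟫_ℝ • e) := by
      rw [hinner, hyd]
      module
    have hgw : g (z + t • y - ⟪e, z + t • y⟫_ℝ • e) ≤ g (z - ⟪e, z⟫_ℝ • e) + K * (t * (2 * δ)) := by
      have h1 := hg.dist_le_mul (z + t • y - ⟪e, z + t • y⟫_ℝ • e) (z - ⟪e, z⟫_ℝ • e)
      rw [Real.dist_eq, dist_eq_norm, hdiff, norm_smul, Real.norm_of_nonneg ht.le] at h1
      have h2 : ‖d - ⟪e, d⟫_ℝ • e‖ ≤ 2 * δ := by
        refine (norm_sub_le _ _).trans ?_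
        rw [norm_smul, he, mul_one, Real.norm_eq_abs]
        linarith
      have h3 : (K : ℝ) * (t * ‖d - ⟪e, d⟫_ℝ • e‖) ≤ K * (t * (2 * δ)) := by gcongr
      linarith [le_abs_self (g (z + t • y - ⟪e, z + t • y⟫_ℝ • e) - g (z - ⟪e, z⟫_ℝ • e))]
    rw [hinner] at hgw ⊢
    have h4 : -δ ≤ ⟪e, d⟫_ℝ := (abs_le.1 hed).1
    nlinarith

/-! ### Density of test functions in the energy space -/

section Approximation
variable {p q κ : ℝ} {a u : (𝔼 n) → ℝ} {G : (𝔼 n) → (𝔼 n)} {Ω : Set (𝔼 n)}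

theorem MemZ.exists_bound (hΩb : Bornology.IsBounded Ω) (haz : MemZ κ Ω a) (hκ : 0 < κ) :
    ∃ A : ℝ, 0 ≤ A ∧ ∀ x ∈ Ω, a x ≤ A := by
  obtain ⟨ha, C, hC, haC⟩ := haz
  rcases Ω.eq_empty_or_nonempty with rfl | ⟨y, hy⟩
  · exact ⟨0, le_rfl, by simp⟩
  · obtain ⟨R, hR⟩ := (Metric.isBounded_iff.1 hΩb)
    have hay := ha y hy
    refine ⟨C * (a y + |R| ^ κ), by positivity, fun x hx => (haC x hx y hy).trans ?_⟩
    gcongr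
    rw [← dist_eq_norm]
    exact (hR hx hy).trans (le_abs_self R)

theorem setLIntegral_density_lt_top_of_bounded (hp : 0 < p) (hq : 0 < q)
    (hΩ : MeasurableSet Ω) (hΩb : Bornology.IsBounded Ω) (ha : ∀ x ∈ Ω, 0 ≤ a x) {A B : ℝ}
    (haA : ∀ x ∈ Ω, a x ≤ A) {V : (𝔼 n) → (𝔼 n)} (hV : ∀ x ∈ Ω, ‖V x‖ ≤ B) :
    ∫⁻ x in Ω, density p q a x ‖V x‖ < ⊤ := by
  calc _ ≤ ∫⁻ x in Ω, ENNReal.ofReal (B ^ p + A * B ^ q) := by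
        refine setLIntegral_mono' hΩ fun x hx => ENNReal.ofReal_le_ofReal ?_
        have h1 := hV x hx
        have h2 := haA x hx
        have h3 := ha x hx
        gcongr
        exact h3.trans h2
    _ < ⊤ := by
        rw [setLIntegral_const]
        exact ENNReal.mul_lt_top ENNReal.ofReal_lt_top hΩb.measure_lt_top

/-- Bounded Sobolev functions with zero boundary values and finite energy are modularly
approximable: localize with a partition of unity and translate each piece into the domain. -/
theorem HasGradZero.modApprox_of_bounded (hp : 1 < p) (hpq : p < q) (hκ : 0 < κ)
    (hqκ : q ≤ p + κ) (hΩ : IsLipschitzDomain Ω)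
    (ham : AEMeasurable a (volume.restrict Ω)) (haz : MemZ κ Ω a) (h : HasGradZero Ω u G) {M : ℝ}
    (hM : ∀ x, |u x| ≤ M) (hE : ∫⁻ x in Ω, density p q a x ‖G x‖ < ⊤) :
    ModApprox p q a Ω G := by
  have hΩm := hΩ.isOpen.measurableSet
  have hM0 : 0 ≤ M := (abs_nonneg _).trans (hM 0)
  obtain ⟨A, hA0, hA⟩ := haz.exists_bound hΩ.isBounded hκ
  have hcomp : IsCompact (closure Ω) := hΩ.isBounded.isCompact_closure
  choose! r hr t₀ ht₀ v δ hδ hgeo using fun x (hx : x ∈ closure Ω) => hΩ.exists_translate hx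
  obtain ⟨s, hsΩ, hs⟩ := hcomp.elim_nhds_subcover (fun x => ball x (r x))
    fun x hx => ball_mem_nhds x (hr x hx)
  obtain ⟨f, hf⟩ := SmoothPartitionOfUnity.exists_isSubordinate (modelWithCornersSelf ℝ (𝔼 n))
    hcomp.isClosed (fun i : s => ball (i : 𝔼 n) (r i)) (fun i => isOpen_ball) (by
      intro x hx
      obtain ⟨i, hi, hxi⟩ := mem_iUnion₂.1 (hs hx)
      exact mem_iUnion.2 ⟨⟨i, hi⟩, hxi⟩)
  have hft : ∀ i, (fun x => f i x) ∈ testFunctions univ := fun i => by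
    refine ⟨(f i).contMDiff.contDiff, ?_, subset_univ _⟩
    exact HasCompactSupport.of_support_subset_isCompact (isCompact_closedBall (i : 𝔼 n) (r i))
      (((subset_tsupport _).trans (hf i)).trans ball_subset_closedBall)
  have hsum : ∀ x ∈ Ω, ∑ i, f i x = 1 := fun x hx => by
    rw [← finsum_eq_sum_of_fintype]
    exact f.sum_eq_one (subset_closure hx)
  set V : s → (𝔼 n) → (𝔼 n) := fun i x => f i x • G x + u x • gradient (fun y => f i y) x with hV
  have hVz : ∀ i, HasGradZero Ω (fun x => f i x * u x) (V i) := fun i => h.mul (hft i)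
  have hmod : ∀ i, ModApprox p q a Ω (V i) := fun i => by
    obtain ⟨B, hB, hfB⟩ := testFunctions.exists_bound (hft i)
    have hi := hsΩ i i.2
    refine (hVz i).modApprox_of_translate hp hpq hκ hqκ hΩ.isOpen hΩ.isBounded ham haz (M := M)
      (fun x => ?_) ?_ (hδ i hi) (ht₀ i hi) (S := Ω ∩ closedBall i (r i)) (fun z hz => ⟨?_, ?_⟩)
      (hgeo i hi)
    · rw [abs_mul, abs_of_nonneg (f.nonneg i x)]
      have := mul_le_mul_of_nonneg_right (f.le_one i x) (abs_nonneg (u x))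
      linarith [hM x]
    · have h1 := setLIntegral_density_add_le (a := a) (W := fun x => u x • gradient (fun y => f i y) x)
        hp hpq hΩm haz.1 ham
        (((hft i).1.continuous.aestronglyMeasurable.smul h.aesm_grad).restrict (s := Ω))
      refine h1.trans_lt (ENNReal.mul_lt_top ENNReal.ofReal_lt_top (ENNReal.add_lt_top.2 ⟨?_, ?_⟩))
      · refine lt_of_le_of_lt (setLIntegral_mono' hΩm fun x hx => ?_) hE
        refine density_mono (by linarith) (by linarith) (haz.1 x hx) (norm_nonneg _) ?_
        simp only [Pi.smul_apply']
        rw [norm_smul, Real.norm_of_nonneg (f.nonneg i x)]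
        exact mul_le_of_le_one_left (norm_nonneg _) (f.le_one i x)
      · refine setLIntegral_density_lt_top_of_bounded (by linarith) (by linarith) hΩm hΩ.isBounded
          haz.1 hA (B := M * B) fun x _ => ?_
        rw [norm_smul]
        exact mul_le_mul (hM x) (hfB x).2 (norm_nonneg _) hM0
    · by_contra hz'
      exact hz (by rw [h.eq_zero z hz', mul_zero])
    · exact ball_subset_closedBall (hf i (subset_tsupport _ (left_ne_zero_of_mul hz)))
  have hall := ModApprox.sum hp hpq hΩm haz.1 ham Finset.univ
    (fun i _ => (hVz i).aesm_grad.restrict) fun i _ => hmod i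
  refine hall.congr ?_
  rw [EventuallyEq, ae_restrict_iff' hΩm]
  refine .of_forall fun x hx => ?_
  have hgrad : ∑ i, gradient (fun y => f i y) x = 0 := by
    have h1 : (fun y => ∑ i, f i y) =ᶠ[𝓝 x] fun _ => 1 := by
      filter_upwards [hΩ.isOpen.mem_nhds hx] with y hy using hsum y hy
    have h2 := h1.fderiv_eq (𝕜 := ℝ)
    rw [fderiv_fun_sum fun i _ => testFunctions.differentiable (hft i) x] at h2
    simp only [gradient, ← map_sum, h2]
    simp
  rw [Finset.sum_apply]
  simp only [hV]
  rw [Finset.sum_add_distrib, ← Finset.sum_smul, ← Finset.smul_sum, hsum x hx, hgrad, one_smul,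
    smul_zero, add_zero]

theorem contDiff_truncation (m : ℝ) : ContDiff ℝ ∞ fun s => m * Real.arctan (s / m) :=
  contDiff_const.mul (Real.contDiff_arctan.comp (contDiff_id.div_const m))

theorem deriv_truncation {m : ℝ} (hm : 0 < m) (s : ℝ) :
    deriv (fun s => m * Real.arctan (s / m)) s = 1 / (1 + (s / m) ^ 2) := by
  have h := ((Real.hasDerivAt_arctan (s / m)).comp s ((hasDerivAt_id s).div_const m)).const_mul m
  have h' := h.deriv
  simp only [Function.comp_def, id] at h'
  rw [h']
  field_simp

/-- Sobolev functions with zero boundary values and finite energy are modularly approximable: the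
smooth truncations `m arctan(u / m)` reduce this to bounded functions. -/
theorem HasGradZero.modApprox (hp : 1 < p) (hpq : p < q) (hκ : 0 < κ)
    (hqκ : q ≤ p + κ) (hΩ : IsLipschitzDomain Ω)
    (ham : AEMeasurable a (volume.restrict Ω)) (haz : MemZ κ Ω a) (h : HasGradZero Ω u G)
    (hE : ∫⁻ x in Ω, density p q a x ‖G x‖ < ⊤) :
    ModApprox p q a Ω G := by
  have hΩm := hΩ.isOpen.measurableSet
  have hp0 : 0 < p := by linarith
  have hq0 : 0 < q := by linarith
  refine ModApprox.of_approx hp hpq hΩm haz.1 ham h.aesm_grad.restrict fun ε hε => ?_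
  set T : ℕ → ℝ → ℝ := fun j s => (j + 1 : ℝ) * Real.arctan (s / (j + 1)) with hT
  have hj : ∀ j : ℕ, (0 : ℝ) < j + 1 := fun j => by positivity
  have hT' : ∀ j s, deriv (T j) s = 1 / (1 + (s / (j + 1)) ^ 2) := fun j s =>
    deriv_truncation (hj j) s
  have hT0 : ∀ j s, 0 ≤ deriv (T j) s := fun j s => by rw [hT']; positivity
  have hT1 : ∀ j s, deriv (T j) s ≤ 1 := fun j s => by
    rw [hT', div_le_one (by positivity)]
    nlinarith [sq_nonneg (s / (j + 1 : ℝ))]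
  have hz : ∀ j, HasGradZero Ω (fun x => T j (u x)) (fun x => deriv (T j) (u x) • G x) := fun j =>
    h.comp (contDiff_truncation _) (by simp [hT]) fun s => by
      rw [abs_of_nonneg (hT0 j s)]; exact hT1 j s
  have hmod : ∀ j, ModApprox p q a Ω (fun x => deriv (T j) (u x) • G x) := fun j => by
    refine (hz j).modApprox_of_bounded hp hpq hκ hqκ hΩ ham haz
      (M := (j + 1) * (Real.pi / 2)) (fun x => ?_) ?_
    · rw [hT, abs_mul, abs_of_pos (hj j)]
      gcongr
      exact abs_le.2 ⟨by linarith [Real.neg_pi_div_two_lt_arctan (u x / (j + 1))],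
        (Real.arctan_lt_pi_div_two _).le⟩
    · refine lt_of_le_of_lt (setLIntegral_mono' hΩm fun x hx => ?_) hE
      refine density_mono hp0 hq0 (haz.1 x hx) (norm_nonneg _) ?_
      rw [norm_smul, Real.norm_of_nonneg (hT0 j _)]
      exact mul_le_of_le_one_left (norm_nonneg _) (hT1 j _)
  have hlim : Tendsto (fun j : ℕ => ∫⁻ x in Ω, density p q a x ‖G x - deriv (T j) (u x) • G x‖)
      atTop (𝓝 0) := by
    have := tendsto_lintegral_of_dominated_convergence' (μ := volume.restrict Ω)
      (F := fun j x => density p q a x ‖G x - deriv (T j) (u x) • G x‖) (f := fun _ => 0)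
      (fun x => density p q a x ‖G x‖) (fun j => ?_) (fun j => ?_) hE.ne ?_
    · simpa using this
    · exact aemeasurable_density ham (h.aesm_grad.restrict.sub (hz j).aesm_grad.restrict)
    · rw [EventuallyLE, ae_restrict_iff' hΩm]
      refine .of_forall fun x hx => density_mono hp0 hq0 (haz.1 x hx) (norm_nonneg _) ?_
      have e : G x - deriv (T j) (u x) • G x = (1 - deriv (T j) (u x)) • G x := by module
      rw [e, norm_smul, Real.norm_of_nonneg (by linarith [hT1 j (u x)])]
      exact mul_le_of_le_one_left (norm_nonneg _) (by linarith [hT0 j (u x)])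
    · refine .of_forall fun x => ?_
      have h1 : Tendsto (fun j : ℕ => deriv (T j) (u x)) atTop (𝓝 1) := by
        simp only [hT']
        have h2 := (tendsto_const_div_atTop_nhds_zero_nat (u x)).comp (tendsto_add_atTop_nat 1)
        have h3 := (((h2.pow 2).const_add 1).inv₀ (by norm_num))
        simpa [Function.comp_def, one_div] using h3
      have h4 : Tendsto (fun j : ℕ => ‖G x - deriv (T j) (u x) • G x‖) atTop (𝓝 0) := by
        simpa using ((tendsto_const_nhds (x := G x)).sub (h1.smul_const (G x))).norm
      have h5 := ((continuous_density (a := a) (x := x) hp0 hq0).tendsto 0).comp h4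
      rwa [density_zero hp0 hq0] at h5
  obtain ⟨j, hlt⟩ := (hlim.eventually (gt_mem_nhds hε)).exists
  exact ⟨_, (hz j).aesm_grad.restrict, hmod j, hlt⟩

theorem WeaklyDifferentiable.aestronglyMeasurable_weakGrad
    (h : WeaklyDifferentiable Ω u) : AEStronglyMeasurable (weakGrad Ω u) (volume.restrict Ω) :=
  h.hasWeakGradient.locallyIntegrableOn_grad.aestronglyMeasurable

/-- The energy of a sum, in terms of the weak gradients of the summands. -/
theorem energy_add_eq (hΩ : IsOpen Ω) {u₀ φ : (𝔼 n) → ℝ} (hu₀ : WeaklyDifferentiable Ω u₀)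
    (hφ : HasWeakGradient Ω φ G) : energy p q a Ω (u₀ + φ) =
      ∫⁻ x in Ω, density p q a x ‖weakGrad Ω u₀ x + G x‖ := by
  refine lintegral_congr_ae ?_
  filter_upwards [(hu₀.hasWeakGradient.add hφ).weakGrad_ae_eq hΩ] with x hx
  rw [hx]
  rfl

theorem energy_eq (hΩ : IsOpen Ω) {φ : (𝔼 n) → ℝ} (hφ : HasWeakGradient Ω φ G) :
    energy p q a Ω φ = ∫⁻ x in Ω, density p q a x ‖G x‖ := by
  refine lintegral_congr_ae ?_
  filter_upwards [hφ.weakGrad_ae_eq hΩ] with x hx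
  rw [hx]
  rfl

theorem testFunctions_subset_energySpace (hp : 0 < p) (hq : 0 < q) (hκ : 0 < κ) (hΩ : IsOpen Ω)
    (hΩb : Bornology.IsBounded Ω) (haz : MemZ κ Ω a) :
    testFunctions Ω ⊆ energySpace p q a Ω := by
  intro φ hφ
  have hz := hasGradZero_of_testFunctions hφ
  obtain ⟨A, -, hA⟩ := haz.exists_bound hΩb hκ
  obtain ⟨B, -, hB⟩ := testFunctions.exists_bound hφ
  refine ⟨hz.memW110 hΩ, ?_⟩
  rw [energy_eq hΩ (hz.hasWeakGradient Ω)]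
  exact setLIntegral_density_lt_top_of_bounded hp hq hΩ.measurableSet hΩb haz.1 hA
    fun x _ => (hB x).2

/-- Absence of the Lavrentiev phenomenon for `q ≤ p + κ`. -/
theorem iInf_energySpace_eq_iInf_testFunctions (hp : 1 < p) (hpq : p < q) (hκ : 0 < κ)
    (hqκ : q ≤ p + κ) (hΩ : IsLipschitzDomain Ω) (ham : AEMeasurable a (volume.restrict Ω))
    (haz : MemZ κ Ω a) {u₀ : (𝔼 n) → ℝ} (hu₀ : WeaklyDifferentiable Ω u₀) :
    (⨅ φ ∈ energySpace p q a Ω, energy p q a Ω (u₀ + φ)) =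
      (⨅ ψ ∈ testFunctions Ω, energy p q a Ω (u₀ + ψ)) := by
  have hp0 : 0 < p := by linarith
  have hq0 : 0 < q := by linarith
  have hΩm := hΩ.isOpen.measurableSet
  refine le_antisymm (biInf_mono (testFunctions_subset_energySpace hp0 hq0 hκ hΩ.isOpen
    hΩ.isBounded haz)) (le_iInf₂ fun φ hφ => ?_)
  have hz := hφ.1.hasGradZero hΩ.isOpen
  have hφw := hφ.1.memW11.weaklyDifferentiable
  have hmod : ModApprox p q a Ω (weakGrad Ω φ) := by
    refine (hz.modApprox hp hpq hκ hqκ hΩ ham haz ?_).congr ?_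
    · refine lt_of_eq_of_lt (setLIntegral_congr_fun hΩm fun x hx => ?_) hφ.2
      simp only [indicator_of_mem hx]
      rfl
    · rw [EventuallyEq, ae_restrict_iff' hΩm]
      exact .of_forall fun x hx => indicator_of_mem hx _
  have key := hmod.iInf_le hp hpq hΩm haz.1 ham
    (hφw.aestronglyMeasurable_weakGrad) (hu₀.aestronglyMeasurable_weakGrad)
  rw [energy_add_eq hΩ.isOpen hu₀ hφw.hasWeakGradient]
  refine le_trans (le_of_eq ?_) key
  refine iInf_congr fun ψ => iInf_congr fun hψ => ?_
  exact energy_add_eq hΩ.isOpen hu₀ ((hasGradZero_of_testFunctions hψ).hasWeakGradient Ω)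

end Approximation

/-! ### The unit ball and the weight -/

/-- A lower unit hemisphere as a graph; the truncation at radius `1/2` makes the function globally
Lipschitz. -/
theorem lipschitzWith_neg_sqrt :
    LipschitzWith 1 fun y : 𝔼 n => -√(1 - (min ‖y‖ (1 / 2)) ^ 2) := by
  refine LipschitzWith.of_dist_le_mul fun x y => ?_
  set s := min ‖x‖ (1 / 2) with hs
  set t := min ‖y‖ (1 / 2) with ht
  have hst : |s - t| ≤ dist x y := by
    refine (abs_min_sub_min_le_max _ _ _ _).trans ?_
    rw [sub_self, abs_zero, dist_eq_norm]
    exact max_le (abs_norm_sub_norm_le x y) (norm_nonneg _)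
  have hs0 : 0 ≤ s := le_min (norm_nonneg _) (by norm_num)
  have ht0 : 0 ≤ t := le_min (norm_nonneg _) (by norm_num)
  have hs1 : s ≤ 1 / 2 := min_le_right _ _
  have ht1 : t ≤ 1 / 2 := min_le_right _ _
  have hhalf : ∀ r : ℝ, 0 ≤ r → r ≤ 1 / 2 → 1 / 2 ≤ √(1 - r ^ 2) := fun r h0 h1 =>
    Real.le_sqrt_of_sq_le (by nlinarith)
  have h1 := hhalf s hs0 hs1
  have h2 := hhalf t ht0 ht1
  have e1 := Real.sq_sqrt (show 0 ≤ 1 - s ^ 2 by nlinarith)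
  have e2 := Real.sq_sqrt (show 0 ≤ 1 - t ^ 2 by nlinarith)
  rw [NNReal.coe_one, one_mul, Real.dist_eq]
  refine le_trans ?_ hst
  set A := √(1 - s ^ 2)
  set B := √(1 - t ^ 2)
  have h3 : |A - B| * (A + B) = |s - t| * (s + t) := by
    rw [← abs_of_nonneg (show 0 ≤ A + B by linarith), ← abs_mul,
      ← abs_of_nonneg (show 0 ≤ s + t by linarith), ← abs_mul, ← abs_neg]
    congr 1
    linarith [show -((A - B) * (A + B)) = B ^ 2 - A ^ 2 by ring]
  have h4 : |-A - -B| = |A - B| := by rw [← abs_neg]; congr 1; ring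
  rw [h4]
  nlinarith [abs_nonneg (A - B), abs_nonneg (s - t)]

theorem isLipschitzDomain_ball : IsLipschitzDomain (ball (0 : 𝔼 n) 1) where
  isOpen := isOpen_ball
  isBounded := isBounded_ball
  local_epigraph x₀ hx₀ := by
    have h0 : ‖x₀‖ = 1 := by
      rw [frontier_ball _ one_ne_zero] at hx₀
      simpa using hx₀
    refine ⟨1 / 4, by norm_num, -x₀, by rwa [norm_neg], 1, _, lipschitzWith_neg_sqrt, ?_⟩
    intro x hx
    rw [Metric.mem_ball, dist_eq_norm] at hx
    set e := -x₀ with he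
    have hen : ‖e‖ = 1 := by rwa [he, norm_neg]
    have hee : ⟪e, e⟫_ℝ = 1 := by rw [real_inner_self_eq_norm_sq, hen]; norm_num
    set d := x - x₀ with hd
    have hxe : x = d - e := by rw [hd, he]; abel
    have hed : |⟪e, d⟫_ℝ| < 1 / 4 := by
      refine (abs_real_inner_le_norm e d).trans_lt ?_
      rwa [hen, one_mul]
    have hs : ⟪e, x⟫_ℝ = ⟪e, d⟫_ℝ - 1 := by rw [hxe, inner_sub_right, hee]
    have hsneg : ⟪e, x⟫_ℝ < 0 := by rw [hs]; linarith [(abs_lt.1 hed).2]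
    have hpe : x - ⟪e, x⟫_ℝ • e = d - ⟪e, d⟫_ℝ • e := by rw [hs, hxe]; module
    have hsmall : ‖x - ⟪e, x⟫_ℝ • e‖ ≤ 1 / 2 := by
      rw [hpe]
      refine (norm_sub_le _ _).trans ?_
      rw [norm_smul, hen, mul_one, Real.norm_eq_abs]
      linarith
    have hpyth : ‖x‖ ^ 2 = ‖x - ⟪e, x⟫_ℝ • e‖ ^ 2 + ⟪e, x⟫_ℝ ^ 2 := by
      rw [norm_sub_sq_real, inner_smul_right, norm_smul, hen, real_inner_comm, mul_one,
        Real.norm_eq_abs, sq_abs]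
      ring
    rw [min_eq_left hsmall, mem_ball_zero_iff, neg_lt, Real.lt_sqrt (by linarith), neg_sq,
      ← sq_lt_one_iff₀ (norm_nonneg x), hpyth]
    constructor <;> intro h <;> linarith

theorem ell_eq (i : Fin n) (x : 𝔼 n) :
    ell i x = max (2 * (x i ^ 2 / ‖x‖) - ‖x‖) 0 := by
  have h1 : ∑ j ∈ Finset.univ.erase i, x j ^ 2 = ‖x‖ ^ 2 - x i ^ 2 := by
    rw [EuclideanSpace.real_norm_sq_eq, ← Finset.add_sum_erase _ _ (Finset.mem_univ i)]
    ring
  rw [ell, h1]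
  rcases eq_or_ne x 0 with rfl | hx
  · simp
  · have hx' : 0 < ‖x‖ := norm_pos_iff.2 hx
    have h2 := max_div_div_right hx'.le (x i ^ 2 - (‖x‖ ^ 2 - x i ^ 2)) 0
    rw [zero_div] at h2
    rw [← h2]
    congr 1
    field_simp
    ring

theorem ell_nonneg (i : Fin n) (x : 𝔼 n) : 0 ≤ ell i x := by
  rw [ell_eq]; exact le_max_right _ _

theorem abs_sq_div_sub_sq_div_le {s t r ρ : ℝ} (hs : |s| ≤ r) (ht : |t| ≤ ρ) :
    |s ^ 2 / r - t ^ 2 / ρ| ≤ 2 * |s - t| + |r - ρ| := by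
  wlog h : ρ ≤ r generalizing s t r ρ
  · have := this ht hs (le_of_not_ge h)
    rwa [abs_sub_comm, abs_sub_comm s t, abs_sub_comm r ρ]
  rcases (abs_nonneg t).trans ht |>.eq_or_lt with h0 | hρ
  · have ht0 : t = 0 := by rw [← h0] at ht; exact abs_nonpos_iff.1 ht
    subst ht0
    rw [← h0]
    simp only [ne_eq, OfNat.ofNat_ne_zero, not_false_eq_true, zero_pow, div_zero, sub_zero]
    rcases (abs_nonneg s).trans hs |>.eq_or_lt with h1 | hr
    · simp [← h1]
    · rw [abs_div, abs_of_pos hr, abs_pow, div_le_iff₀ hr]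
      nlinarith [abs_nonneg s]
  · have hr : 0 < r := hρ.trans_le h
    have e : s ^ 2 / r - t ^ 2 / ρ = (s - t) * ((s + t) / r) + (ρ - r) * (t ^ 2 / (r * ρ)) := by
      field_simp
      ring
    rw [e]
    refine (abs_add_le _ _).trans (add_le_add ?_ ?_)
    · rw [abs_mul, mul_comm]
      refine mul_le_mul_of_nonneg_right ?_ (abs_nonneg _)
      rw [abs_div, abs_of_pos hr, div_le_iff₀ hr]
      linarith [abs_add_le s t]
    · rw [abs_mul, abs_sub_comm]
      refine mul_le_of_le_one_right (abs_nonneg _) ?_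
      rw [abs_of_nonneg (by positivity), div_le_one (by positivity), ← sq_abs]
      nlinarith [abs_nonneg t]

theorem abs_apply_le_norm (i : Fin n) (x : 𝔼 n) : |x i| ≤ ‖x‖ :=
  PiLp.norm_apply_le x i

theorem ell_le_add (i : Fin n) (x y : 𝔼 n) : ell i x ≤ ell i y + 7 * ‖x - y‖ := by
  have h1 := abs_sq_div_sub_sq_div_le (abs_apply_le_norm i x) (abs_apply_le_norm i y)
  have h2 : |x i - y i| ≤ ‖x - y‖ := abs_apply_le_norm i (x - y)
  have h3 := abs_norm_sub_norm_le x y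
  have h4 := le_abs_self (x i ^ 2 / ‖x‖ - y i ^ 2 / ‖y‖)
  have h5 := neg_abs_le (‖x‖ - ‖y‖)
  rw [ell_eq i x]
  refine max_le ?_ (add_nonneg (ell_nonneg i y) (by positivity))
  have h6 : 2 * (y i ^ 2 / ‖y‖) - ‖y‖ ≤ ell i y := by rw [ell_eq]; exact le_max_left _ _
  linarith

theorem memZ_ell_rpow {κ : ℝ} (hκ : 0 < κ) (i : Fin n) (Ω : Set (𝔼 n)) :
    MemZ κ Ω fun x => ell i x ^ κ := by
  refine ⟨fun x _ => Real.rpow_nonneg (ell_nonneg i x) κ, 14 ^ κ, by positivity, fun x _ y _ => ?_⟩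
  have h0 := ell_nonneg i y
  have hd := norm_nonneg (x - y)
  have h1 := ell_le_add i x y
  rcases le_total (ell i y) ‖x - y‖ with h | h
  · calc ell i x ^ κ ≤ (14 * ‖x - y‖) ^ κ :=
          Real.rpow_le_rpow (ell_nonneg i x) (by linarith) hκ.le
      _ = 14 ^ κ * ‖x - y‖ ^ κ := Real.mul_rpow (by norm_num) hd
      _ ≤ _ := by
          gcongr
          linarith [Real.rpow_nonneg h0 κ]
  · calc ell i x ^ κ ≤ (14 * ell i y) ^ κ :=
          Real.rpow_le_rpow (ell_nonneg i x) (by linarith) hκ.le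
      _ = 14 ^ κ * ell i y ^ κ := Real.mul_rpow (by norm_num) h0
      _ ≤ _ := by
          gcongr
          linarith [Real.rpow_nonneg hd κ]

theorem measurable_ell (i : Fin n) : Measurable (ell i) := by
  have : ell i = fun x : 𝔼 n => max (2 * (x i ^ 2 / ‖x‖) - ‖x‖) 0 := funext (ell_eq i)
  rw [this]
  have : Measurable fun x : 𝔼 n => x i := (EuclideanSpace.proj i).continuous.measurable
  fun_prop

theorem ell_eq_zero {i : Fin n} {x : 𝔼 n} (h : |x i| ≤ ‖x‖ / 2) : ell i x = 0 := by
  rw [ell_eq, max_eq_right]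
  rcases eq_or_ne x 0 with rfl | hx
  · simp
  have hx' : 0 < ‖x‖ := norm_pos_iff.2 hx
  rw [sub_nonpos, ← le_div_iff₀' (by norm_num), div_le_iff₀ hx', ← sq_abs]
  nlinarith [abs_nonneg (x i)]

theorem half_norm_le_ell {i : Fin n} {x : 𝔼 n} (h : 9 / 10 * ‖x‖ ≤ |x i|) :
    ‖x‖ / 2 ≤ ell i x := by
  rw [ell_eq]
  refine le_trans ?_ (le_max_left _ _)
  rcases eq_or_ne x 0 with rfl | hx
  · simp
  have hx' : 0 < ‖x‖ := norm_pos_iff.2 hx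
  have : 3 / 4 * ‖x‖ ≤ x i ^ 2 / ‖x‖ := by
    rw [le_div_iff₀ hx', ← sq_abs]
    nlinarith [abs_nonneg (x i)]
  linarith

/-! ### The lower bound for regular competitors -/

theorem lintegral_Ioo_rpow {τ : ℝ} (hτ : -1 < τ) :
    ∫⁻ t in Ioo (0 : ℝ) 1, ENNReal.ofReal (t ^ τ) = ENNReal.ofReal (1 / (τ + 1)) := by
  have hi : IntegrableOn (fun t : ℝ => t ^ τ) (Ioo 0 1) :=
    (intervalIntegral.integrableOn_Ioo_rpow_iff one_pos).2 hτ
  rw [← ofReal_integral_eq_lintegral_ofReal hi, ← integral_Ioc_eq_integral_Ioo,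
    ← intervalIntegral.integral_of_le zero_le_one, integral_rpow (Or.inl hτ)]
  · rw [Real.one_rpow, Real.zero_rpow (by linarith), sub_zero]
  · rw [EventuallyLE, ae_restrict_iff' measurableSet_Ioo]
    exact .of_forall fun t ht => Real.rpow_nonneg ht.1.le _

theorem lintegral_comp_smul {h : (𝔼 n) → ℝ≥0∞} {t : ℝ} (ht : 0 < t) :
    ∫⁻ y, h (t • y) = ENNReal.ofReal (t ^ (-(n : ℝ))) * ∫⁻ y, h y := by
  have h1 : MeasurableEmbedding fun y : 𝔼 n => t • y :=
    (Homeomorph.smulOfNeZero t ht.ne').measurableEmbedding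
  rw [← h1.lintegral_map h, Measure.map_addHaar_smul volume ht.ne', lintegral_smul_measure,
    finrank_euclideanSpace, Fintype.card_fin, abs_of_pos (by positivity), Real.rpow_neg ht.le,
    Real.rpow_natCast, smul_eq_mul]

/-- Young-type inequality separating a quantity from its `q`-th power at the threshold `l`. -/
theorem le_add_rpow_mul {r l q : ℝ} (hr : 0 ≤ r) (hl : 0 < l) (hq : 1 < q) :
    r ≤ l + l ^ (1 - q) * r ^ q := by
  rcases le_total r l with h | h
  · linarith [show 0 ≤ l ^ (1 - q) * r ^ q by positivity]
  · have hr' : 0 < r := hl.trans_le h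
    have h1 : r ^ (1 - q) ≤ l ^ (1 - q) := Real.rpow_le_rpow_of_nonpos hl h (by linarith)
    have h2 : r ^ (1 - q) * r ^ q = r := by
      rw [← Real.rpow_add hr', sub_add_cancel, Real.rpow_one]
    nlinarith [Real.rpow_nonneg hr q]

/-- The fundamental theorem of calculus along the rays through the points of a set `A`. -/
theorem mul_volume_le_lintegral_gradient {A : Set (𝔼 n)} (hA : MeasurableSet A)
    (hA2 : ∀ y ∈ A, ‖y‖ ≤ 2) {w : (𝔼 n) → ℝ} (hw : ContDiff ℝ 1 w) {s : ℝ}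
    (hs : ∀ y ∈ A, s ≤ |w y - w 0|) :
    ENNReal.ofReal s * volume A ≤
      2 * ∫⁻ t in Ioo (0 : ℝ) 1, ∫⁻ y in A, ‖gradient w (t • y)‖ₑ := by
  have hcg : Continuous fun z : (𝔼 n) × ℝ => gradient w (z.2 • z.1) :=
    (continuous_gradient hw).comp (continuous_snd.smul continuous_fst)
  have hpt : ∀ y ∈ A, ENNReal.ofReal s ≤
      2 * ∫⁻ t in Ioo (0 : ℝ) 1, ‖gradient w (t • y)‖ₑ := by
    intro y hy
    have hd : ∀ t ∈ uIcc (0 : ℝ) 1, HasDerivAt (fun t : ℝ => w (t • y))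
        (⟪gradient w (t • y), y⟫_ℝ) t := fun t _ => by
      rw [inner_gradient]
      have h1 := ((hw.differentiable one_ne_zero) (t • y)).hasFDerivAt.comp_hasDerivAt t
        ((hasDerivAt_id t).smul_const y)
      simpa [Function.comp_def] using h1
    have hcont : Continuous fun t : ℝ => ⟪gradient w (t • y), y⟫_ℝ :=
      ((continuous_gradient hw).comp (continuous_id.smul continuous_const)).inner continuous_const
    have hftc := intervalIntegral.integral_eq_sub_of_hasDerivAt hd (hcont.intervalIntegrable 0 1)
    rw [one_smul, zero_smul, intervalIntegral.integral_of_le zero_le_one,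
      integral_Ioc_eq_integral_Ioo] at hftc
    calc ENNReal.ofReal s ≤ ‖w y - w 0‖ₑ := by
          rw [← ofReal_norm]; exact ENNReal.ofReal_le_ofReal (hs y hy)
      _ ≤ ∫⁻ t in Ioo (0 : ℝ) 1, ‖⟪gradient w (t • y), y⟫_ℝ‖ₑ := by
          rw [← hftc]; exact enorm_integral_le_lintegral_enorm _
      _ ≤ ∫⁻ t in Ioo (0 : ℝ) 1, 2 * ‖gradient w (t • y)‖ₑ := by
          refine lintegral_mono fun t => ?_
          have h2 : ‖⟪gradient w (t • y), y⟫_ℝ‖ ≤ 2 * ‖gradient w (t • y)‖ := by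
            refine (norm_inner_le_norm _ _).trans ?_
            rw [mul_comm]
            gcongr
            exact hA2 y hy
          simp only [← ofReal_norm]
          refine (ENNReal.ofReal_le_ofReal h2).trans (le_of_eq ?_)
          rw [ENNReal.ofReal_mul (by norm_num)]
          simp
      _ = _ := lintegral_const_mul' _ _ (by simp)
  calc ENNReal.ofReal s * volume A = ∫⁻ _ in A, ENNReal.ofReal s := by rw [setLIntegral_const]
    _ ≤ ∫⁻ y in A, 2 * ∫⁻ t in Ioo (0 : ℝ) 1, ‖gradient w (t • y)‖ₑ := setLIntegral_mono' hA hpt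
    _ = 2 * ∫⁻ y in A, ∫⁻ t in Ioo (0 : ℝ) 1, ‖gradient w (t • y)‖ₑ :=
        lintegral_const_mul' _ _ (by simp)
    _ = _ := by
        rw [lintegral_lintegral_swap]
        exact hcg.enorm.measurable.aemeasurable

/-- The mean over `A` of the `q`-th power of the gradient at scale `t` is controlled by the energy
on the unit ball, with a power of `t` produced by the weight and by the change of variables. -/
theorem lintegral_gradient_rpow_le {p q κ : ℝ} (hκ : 0 < κ) {i : Fin n}
    {A : Set (𝔼 n)} (hA : MeasurableSet A) (hA1 : ∀ y ∈ A, 1 ≤ ‖y‖)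
    (hAi : ∀ y ∈ A, 9 / 10 * ‖y‖ ≤ |y i|) (hq : 0 < q) {V : (𝔼 n) → (𝔼 n)} {t : ℝ} (ht : 0 < t)
    (hV : ∀ y ∈ A, t • y ∉ ball (0 : 𝔼 n) 1 → V (t • y) = 0) :
    ∫⁻ y in A, ENNReal.ofReal (‖V (t • y)‖ ^ q) ≤ ENNReal.ofReal (2 ^ κ * t ^ (-κ - n)) *
      ∫⁻ x in ball (0 : 𝔼 n) 1, density p q (fun x => ell i x ^ κ) x ‖V x‖ := by
  set h : (𝔼 n) → ℝ≥0∞ := (ball (0 : 𝔼 n) 1).indicator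
    fun x => density p q (fun x => ell i x ^ κ) x ‖V x‖ with hh
  have hpt : ∀ y ∈ A, ENNReal.ofReal (‖V (t • y)‖ ^ q) ≤
      ENNReal.ofReal (2 ^ κ * t ^ (-κ)) * h (t • y) := by
    intro y hy
    by_cases hb : t • y ∈ ball (0 : 𝔼 n) 1
    · rw [hh, indicator_of_mem hb, density, ← ENNReal.ofReal_mul (by positivity)]
      refine ENNReal.ofReal_le_ofReal ?_
      have h1 : t / 2 ≤ ell i (t • y) := by
        have h2 : 9 / 10 * ‖t • y‖ ≤ |(t • y) i| := by
          rw [norm_smul, Real.norm_of_nonneg ht.le, PiLp.smul_apply, smul_eq_mul, abs_mul,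
            abs_of_pos ht]
          nlinarith [hAi y hy]
        refine le_trans ?_ (half_norm_le_ell h2)
        rw [norm_smul, Real.norm_of_nonneg ht.le]
        nlinarith [hA1 y hy]
      have h3 : (t / 2) ^ κ ≤ ell i (t • y) ^ κ := Real.rpow_le_rpow (by positivity) h1 hκ.le
      have h4 : 2 ^ κ * t ^ (-κ) * (t / 2) ^ κ = 1 := by
        rw [Real.div_rpow ht.le (by norm_num), Real.rpow_neg ht.le]
        have := Real.rpow_pos_of_pos ht κ
        have := Real.rpow_pos_of_pos (show (0 : ℝ) < 2 by norm_num) κ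
        field_simp
      have h5 : (0 : ℝ) ≤ 2 ^ κ * t ^ (-κ) := by positivity
      have h6 : 1 ≤ 2 ^ κ * t ^ (-κ) * ell i (t • y) ^ κ := by
        rw [← h4]; gcongr
      have h7 := mul_le_mul_of_nonneg_right h6 (Real.rpow_nonneg (norm_nonneg (V (t • y))) q)
      have h8 : 0 ≤ 2 ^ κ * t ^ (-κ) * ‖V (t • y)‖ ^ p := by positivity
      linarith
    · simp [hV y hy hb, hq.ne']
  calc _ ≤ ∫⁻ y in A, ENNReal.ofReal (2 ^ κ * t ^ (-κ)) * h (t • y) := setLIntegral_mono' hA hpt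
    _ ≤ ∫⁻ y, ENNReal.ofReal (2 ^ κ * t ^ (-κ)) * h (t • y) := setLIntegral_le_lintegral _ _
    _ = _ := by
        rw [lintegral_const_mul' _ _ ENNReal.ofReal_ne_top, lintegral_comp_smul ht, ← mul_assoc,
          ← ENNReal.ofReal_mul (by positivity), mul_assoc, ← Real.rpow_add ht, ← sub_eq_add_neg, hh,
          lintegral_indicator measurableSet_ball]

/-- Let the values of a `C¹` function on a set `A` of positive measure, contained in the cones where
the weight is positive, differ by at least `s` from its value at the origin, and let its gradient
vanish outside the unit ball on the rays through `A`. Then its energy is at least `c s^q`: as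
`q > n + κ`, the powers of the scale that enter through the weight and the dimension remain
integrable along the rays. -/
theorem exists_const_mul_rpow_le_energy {p q κ : ℝ} (hκ : 0 < κ) (hn : 1 ≤ n)
    (hq : (n : ℝ) + κ < q) {i : Fin n} {A : Set (𝔼 n)} (hA : MeasurableSet A)
    (hA1 : ∀ y ∈ A, 1 ≤ ‖y‖) (hA2 : ∀ y ∈ A, ‖y‖ ≤ 2) (hAi : ∀ y ∈ A, 9 / 10 * ‖y‖ ≤ |y i|)
    (hApos : 0 < volume A) :
    ∃ c : ℝ, 0 < c ∧ ∀ (s : ℝ) (w : (𝔼 n) → ℝ), 0 < s → ContDiff ℝ 1 w →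
      (∀ y ∈ A, ∀ t : ℝ, 0 < t → t • y ∉ ball (0 : 𝔼 n) 1 → gradient w (t • y) = 0) →
      (∀ y ∈ A, s ≤ |w y - w 0|) →
      ENNReal.ofReal (c * s ^ q) ≤
        ∫⁻ x in ball (0 : 𝔼 n) 1, density p q (fun x => ell i x ^ κ) x ‖gradient w x‖ := by
  have hn' : (1 : ℝ) ≤ n := by exact_mod_cast hn
  have hq1 : 1 < q := by linarith
  -- an exponent `σ < 1` for which `σ (q - 1) - κ - n > -1`
  set σ := ((κ + n - 1) / (q - 1) + 1) / 2 with hσ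
  have hσ0 : (κ + n - 1) / (q - 1) < 1 := by rw [div_lt_one (by linarith)]; linarith
  have hσ1 : σ < 1 := by rw [hσ]; linarith
  have hσ2 : (κ + n - 1) / (q - 1) < σ := by rw [hσ]; linarith
  set τ := σ * (q - 1) - κ - n with hτ
  have hτ1 : -1 < τ := by
    rw [div_lt_iff₀ (by linarith)] at hσ2
    rw [hτ]; linarith
  have hAfin : volume A ≠ ⊤ :=
    ((measure_mono fun y hy => mem_closedBall_zero_iff.2 (hA2 y hy)).trans_lt
      measure_closedBall_lt_top).ne
  set α := (volume A).toReal with hα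
  have hα0 : 0 < α := ENNReal.toReal_pos hApos.ne' hAfin
  have hαA : volume A = ENNReal.ofReal α := (ENNReal.ofReal_toReal hAfin).symm
  set K := 2 ^ κ / (τ + 1) with hK
  have hK0 : 0 < K := div_pos (by positivity) (by linarith)
  -- with the threshold `s m t^(-σ)` for the gradient at scale `t`, the part of the gradient below the
  -- threshold accounts for half of `s` only
  set m := (1 - σ) / 4 with hm
  have hm0 : 0 < m := by rw [hm]; linarith
  refine ⟨α * m ^ (q - 1) / (4 * K), by positivity, fun s w hs hw hwz hws => ?_⟩
  set F := ∫⁻ x in ball (0 : 𝔼 n) 1, density p q (fun x => ell i x ^ κ) x ‖gradient w x‖ with hF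
  rcases eq_or_ne F ⊤ with hFt | hFt
  · rw [hFt]; exact le_top
  set f := F.toReal with hf
  have hf0 : 0 ≤ f := ENNReal.toReal_nonneg
  have hfF : F = ENNReal.ofReal f := (ENNReal.ofReal_toReal hFt).symm
  set Λ := s * m with hΛ
  have hΛ0 : 0 < Λ := by positivity
  have hscale : ∀ t ∈ Ioo (0 : ℝ) 1, ∫⁻ y in A, ‖gradient w (t • y)‖ₑ ≤
      ENNReal.ofReal (Λ * α) * ENNReal.ofReal (t ^ (-σ)) +
      ENNReal.ofReal (Λ ^ (1 - q) * 2 ^ κ * f) * ENNReal.ofReal (t ^ τ) := by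
    intro t ht
    have ht0 := ht.1
    set l := Λ * t ^ (-σ) with hl
    have hl0 : 0 < l := by positivity
    have h1 := lintegral_gradient_rpow_le (p := p) hκ hA hA1 hAi (by linarith : 0 < q) ht0
      fun y hy => hwz y hy t ht0
    calc _ ≤ ∫⁻ y in A, (ENNReal.ofReal l +
          ENNReal.ofReal (l ^ (1 - q)) * ENNReal.ofReal (‖gradient w (t • y)‖ ^ q)) := by
          refine lintegral_mono fun y => ?_
          simp only
          rw [← ofReal_norm, ← ENNReal.ofReal_mul (by positivity),
            ← ENNReal.ofReal_add (by positivity) (by positivity)]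
          exact ENNReal.ofReal_le_ofReal (le_add_rpow_mul (norm_nonneg _) hl0 hq1)
      _ = ENNReal.ofReal l * volume A + ENNReal.ofReal (l ^ (1 - q)) *
          ∫⁻ y in A, ENNReal.ofReal (‖gradient w (t • y)‖ ^ q) := by
          rw [lintegral_add_left measurable_const, setLIntegral_const,
            lintegral_const_mul' _ _ ENNReal.ofReal_ne_top]
      _ ≤ ENNReal.ofReal l * volume A + ENNReal.ofReal (l ^ (1 - q)) *
          (ENNReal.ofReal (2 ^ κ * t ^ (-κ - n)) * F) := by gcongr
      _ = _ := by
          rw [hαA, hfF, ← ENNReal.ofReal_mul (by positivity), ← ENNReal.ofReal_mul (by positivity),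
            ← ENNReal.ofReal_mul (by positivity), ← ENNReal.ofReal_mul (by positivity),
            ← ENNReal.ofReal_mul (by positivity)]
          congr 2
          · rw [hl]; ring
          · have e1 : l ^ (1 - q) = Λ ^ (1 - q) * t ^ (-σ * (1 - q)) := by
              rw [hl, Real.mul_rpow hΛ0.le (by positivity), ← Real.rpow_mul ht0.le]
            have e2 : t ^ τ = t ^ (-σ * (1 - q)) * t ^ (-κ - (n : ℝ)) := by
              rw [← Real.rpow_add ht0, hτ]
              congr 1
              ring
            rw [e1, e2]
            ring
  have hm1 : Measurable fun t : ℝ => ENNReal.ofReal (t ^ (-σ)) :=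
    (measurable_id.pow_const _).ennreal_ofReal
  have hτ0 : 0 < τ + 1 := by linarith
  have hσ0' : 0 < -σ + 1 := by linarith
  have hmain : ENNReal.ofReal (s * α) ≤
      ENNReal.ofReal (2 * (Λ * α * (1 / (-σ + 1)) + Λ ^ (1 - q) * 2 ^ κ * f * (1 / (τ + 1)))) := by
    rw [ENNReal.ofReal_mul hs.le, ← hαA]
    refine (mul_volume_le_lintegral_gradient hA hA2 hw hws).trans ?_
    rw [ENNReal.ofReal_mul (by norm_num), ENNReal.ofReal_ofNat]
    refine mul_le_mul_right ?_ _
    refine (setLIntegral_mono' measurableSet_Ioo hscale).trans (le_of_eq ?_)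
    rw [lintegral_add_left (hm1.const_mul _), lintegral_const_mul' _ _ ENNReal.ofReal_ne_top,
      lintegral_const_mul' _ _ ENNReal.ofReal_ne_top, lintegral_Ioo_rpow (by linarith),
      lintegral_Ioo_rpow hτ1, ← ENNReal.ofReal_mul (by positivity),
      ← ENNReal.ofReal_mul (by positivity), ← ENNReal.ofReal_add (by positivity) (by positivity)]
  rw [ENNReal.ofReal_le_ofReal_iff (by positivity)] at hmain
  rw [hfF]
  refine ENNReal.ofReal_le_ofReal ?_
  have e3 : Λ * α * (1 / (-σ + 1)) = s * α / 4 := by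
    rw [hΛ, hm]
    field_simp
    ring
  have e4 : Λ ^ (1 - q) * 2 ^ κ * f * (1 / (τ + 1)) = Λ ^ (1 - q) * K * f := by rw [hK]; ring
  rw [e3, e4] at hmain
  have h5 : s * α / 4 ≤ Λ ^ (1 - q) * (K * f) := by linarith
  have h6 : Λ ^ (q - 1) * (s * α / 4) ≤ K * f := by
    have := mul_le_mul_of_nonneg_left h5 (Real.rpow_nonneg hΛ0.le (q - 1))
    rwa [← mul_assoc (Λ ^ (q - 1)) (Λ ^ (1 - q)), ← Real.rpow_add hΛ0, sub_add_sub_cancel', sub_self,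
      Real.rpow_zero, one_mul] at this
  have h7 : Λ ^ (q - 1) * s = m ^ (q - 1) * s ^ q := by
    have : s ^ q = s ^ (q - 1) * s := by
      rw [← Real.rpow_add_one hs.ne', sub_add_cancel]
    rw [hΛ, Real.mul_rpow hs.le hm0.le, this]
    ring
  rw [div_mul_eq_mul_div, div_le_iff₀ (by positivity)]
  have h8 : Λ ^ (q - 1) * (s * α / 4) = α * m ^ (q - 1) * s ^ q / 4 := by
    linear_combination (α / 4) * h7
  linarith

/-! ### A singular competitor that test functions cannot approach -/

/-- A smooth monotone profile equal to `-1` on `(-∞, -1/2]` and to `1` on `[1/2, ∞)`. -/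
def profile (τ : ℝ) : ℝ := 2 * Real.smoothTransition (τ + 1 / 2) - 1

theorem contDiff_profile : ContDiff ℝ ∞ profile :=
  (contDiff_const.mul (Real.smoothTransition.contDiff.comp (contDiff_id.add contDiff_const))).sub
    contDiff_const

theorem abs_profile_le (τ : ℝ) : |profile τ| ≤ 1 := by
  have h1 := Real.smoothTransition.nonneg (τ + 1 / 2)
  have h2 := Real.smoothTransition.le_one (τ + 1 / 2)
  exact abs_le.2 ⟨by unfold profile; linarith, by unfold profile; linarith⟩

theorem profile_of_half_le {τ : ℝ} (h : 1 / 2 ≤ τ) : profile τ = 1 := by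
  rw [profile, Real.smoothTransition.one_of_one_le (by linarith)]; norm_num

theorem profile_of_le_neg_half {τ : ℝ} (h : τ ≤ -1 / 2) : profile τ = -1 := by
  rw [profile, Real.smoothTransition.zero_of_nonpos (by linarith)]; norm_num

theorem exists_lipschitz_profile :
    ∃ L : ℝ, 0 ≤ L ∧ ∀ s ∈ Icc (-1 : ℝ) 1, ∀ t ∈ Icc (-1 : ℝ) 1,
      |profile s - profile t| ≤ L * |s - t| := by
  obtain ⟨K, hK⟩ := (contDiff_profile.contDiffOn (s := Icc (-1 : ℝ) 1)).exists_lipschitzOnWith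
    (by simp) (convex_Icc _ _) isCompact_Icc
  exact ⟨K, K.2, fun s hs t ht => by simpa [Real.dist_eq] using hK.dist_le_mul s hs t ht⟩

/-- The function of the direction `x / |x|` that equals `s` in a cone around the positive `i`-th
coordinate axis and `-s` in the opposite cone. -/
def angular (i : Fin n) (s : ℝ) (x : 𝔼 n) : ℝ := s * profile (x i / ‖x‖)

section Angular
variable {i : Fin n} {s : ℝ} {x : 𝔼 n}

theorem abs_angular_le (hs : 0 ≤ s) (x : 𝔼 n) : |angular i s x| ≤ s := by
  rw [angular, abs_mul, abs_of_nonneg hs]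
  exact mul_le_of_le_one_right hs (abs_profile_le _)

theorem angular_eq (hx : x ≠ 0) (h : ‖x‖ / 2 ≤ x i) : angular i s x = s := by
  have hx' : 0 < ‖x‖ := norm_pos_iff.2 hx
  rw [angular, profile_of_half_le, mul_one]
  rw [le_div_iff₀ hx']; linarith

theorem angular_eq_neg (hx : x ≠ 0) (h : x i ≤ -(‖x‖ / 2)) : angular i s x = -s := by
  have hx' : 0 < ‖x‖ := norm_pos_iff.2 hx
  rw [angular, profile_of_le_neg_half, mul_neg_one]
  rw [div_le_iff₀ hx']; linarith

theorem contDiff_apply_coord (i : Fin n) : ContDiff ℝ ∞ fun x : 𝔼 n => x i :=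
  (EuclideanSpace.proj (𝕜 := ℝ) i).contDiff

theorem contDiffAt_angular (hx : x ≠ 0) : ContDiffAt ℝ ∞ (angular i s) x :=
  contDiffAt_const.mul (contDiff_profile.contDiffAt.comp x
    ((contDiff_apply_coord i).contDiffAt.div (contDiffAt_norm ℝ hx) (norm_ne_zero_iff.2 hx)))

theorem differentiableAt_angular (hx : x ≠ 0) : DifferentiableAt ℝ (angular i s) x :=
  (contDiffAt_angular hx).differentiableAt (by simp)

theorem exists_norm_gradient_angular_le (i : Fin n) :
    ∃ L : ℝ, 0 ≤ L ∧ ∀ s : ℝ, 0 ≤ s → ∀ x ≠ 0, ‖gradient (angular i s) x‖ ≤ s * L / ‖x‖ := by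
  obtain ⟨L, hL, hlip⟩ := exists_lipschitz_profile
  refine ⟨2 * L, by positivity, fun s hs x hx => ?_⟩
  have hx' : 0 < ‖x‖ := norm_pos_iff.2 hx
  rw [norm_gradient]
  refine norm_fderiv_le_of_lip' ℝ (by positivity) ?_
  filter_upwards [isOpen_ne.mem_nhds hx] with y hy
  have hy' : 0 < ‖y‖ := norm_pos_iff.2 hy
  have hmem : ∀ z : 𝔼 n, z ≠ 0 → z i / ‖z‖ ∈ Icc (-1 : ℝ) 1 := fun z hz => by
    have hz' : 0 < ‖z‖ := norm_pos_iff.2 hz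
    rw [mem_Icc, ← abs_le, abs_div, abs_norm, div_le_one hz']
    exact abs_apply_le_norm i z
  have h1 := hlip _ (hmem y hy) _ (hmem x hx)
  have h2 : |y i / ‖y‖ - x i / ‖x‖| ≤ 2 * ‖y - x‖ / ‖x‖ := by
    have e : y i / ‖y‖ - x i / ‖x‖ = ((y i - x i) + y i / ‖y‖ * (‖x‖ - ‖y‖)) / ‖x‖ := by
      field_simp
      ring
    rw [e, abs_div, abs_norm]
    gcongr
    refine (abs_add_le _ _).trans ?_
    have h3 : |y i - x i| ≤ ‖y - x‖ := abs_apply_le_norm i (y - x)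
    have h4 : |‖x‖ - ‖y‖| ≤ ‖y - x‖ := by rw [norm_sub_rev]; exact abs_norm_sub_norm_le x y
    have h5 : |y i / ‖y‖| ≤ 1 := abs_le.2 (hmem y hy)
    rw [abs_mul]
    nlinarith [abs_nonneg (y i / ‖y‖), abs_nonneg (‖x‖ - ‖y‖)]
  simp only [angular]
  rw [← mul_sub, norm_mul, Real.norm_of_nonneg hs, Real.norm_eq_abs]
  calc s * |profile (y i / ‖y‖) - profile (x i / ‖x‖)| ≤ s * (L * (2 * ‖y - x‖ / ‖x‖)) := by
        gcongr
        exact h1.trans (by gcongr)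
    _ = s * (2 * L) / ‖x‖ * ‖y - x‖ := by ring

theorem gradient_angular_eq_zero (h : ‖x‖ / 2 < |x i|) : gradient (angular i s) x = 0 := by
  have hx : x ≠ 0 := by rintro rfl; simp at h
  have hopen : ∀ᶠ y in 𝓝 x, y ≠ (0 : 𝔼 n) := isOpen_ne.mem_nhds hx
  have hc : Continuous fun y : 𝔼 n => y i := (contDiff_apply_coord i).continuous
  rcases le_or_gt 0 (x i) with h0 | h0
  · rw [abs_of_nonneg h0] at h
    have h1 : ∀ᶠ y in 𝓝 x, ‖y‖ / 2 < y i :=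
      (continuous_norm.div_const 2).continuousAt.eventually_lt hc.continuousAt h
    have h2 : angular i s =ᶠ[𝓝 x] fun _ => s := by
      filter_upwards [hopen, h1] with y hy hy' using angular_eq hy hy'.le
    rw [h2.gradient_eq, gradient_fun_const]
  · rw [abs_of_neg h0] at h
    have h1 : ∀ᶠ y in 𝓝 x, ‖y‖ / 2 < -y i :=
      (continuous_norm.div_const 2).continuousAt.eventually_lt hc.neg.continuousAt h
    have h2 : angular i s =ᶠ[𝓝 x] fun _ => -s := by
      filter_upwards [hopen, h1] with y hy hy' using angular_eq_neg hy (by linarith)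
    rw [h2.gradient_eq, gradient_fun_const]

/-- The gradient of `angular i s` lives where the weight vanishes, so that its energy is its
`p`-energy. -/
theorem density_gradient_angular {p q κ : ℝ} (hκ : 0 < κ) (hq : 0 < q) :
    density p q (fun x => ell i x ^ κ) x ‖gradient (angular i s) x‖ =
      ENNReal.ofReal (‖gradient (angular i s) x‖ ^ p) := by
  rw [density]
  congr 1
  rcases le_or_gt |x i| (‖x‖ / 2) with h | h
  · rw [ell_eq_zero h, Real.zero_rpow hκ.ne', zero_mul, add_zero]
  · rw [gradient_angular_eq_zero h, norm_zero, Real.zero_rpow hq.ne', mul_zero, add_zero]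

theorem contDiff_mul_angular {f : (𝔼 n) → ℝ} (hf : ContDiff ℝ ∞ f) (hf0 : f =ᶠ[𝓝 0] 0) :
    ContDiff ℝ ∞ fun x => f x * angular i s x := by
  rw [contDiff_iff_contDiffAt]
  intro x
  rcases eq_or_ne x 0 with rfl | hx
  · refine (contDiffAt_const (c := (0 : ℝ))).congr_of_eventuallyEq ?_
    filter_upwards [hf0] with y hy
    rw [hy, Pi.zero_apply, zero_mul]
  · exact hf.contDiffAt.mul (contDiffAt_angular hx)

theorem gradient_mul_angular {f : (𝔼 n) → ℝ} (hf : ContDiff ℝ ∞ f) (hx : x ≠ 0) :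
    gradient (fun x => f x * angular i s x) x =
      f x • gradient (angular i s) x + angular i s x • gradient f x :=
  gradient_fun_mul (hf.differentiable (by simp) x) (differentiableAt_angular hx)

theorem measurable_gradient (f : (𝔼 n) → ℝ) : Measurable (gradient f) :=
  (InnerProductSpace.toDual ℝ (𝔼 n)).symm.continuous.measurable.comp (measurable_fderiv ℝ f)

theorem measurable_angular : Measurable (angular i s) :=
  measurable_const.mul (contDiff_profile.continuous.measurable.comp
    ((contDiff_apply_coord i).continuous.measurable.div measurable_norm))

/-- For `f` with compact support in the unit ball and equal to `1` near the origin,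
`f * angular i s` has zero boundary values: the approximating test functions are cut off at scale `ε` around the origin, where
the cut-off contributes a gradient of order `1 / |x|`, which is integrable since `n ≥ 2`. -/
theorem hasGradZero_mul_angular (hn : 2 ≤ n) {f : (𝔼 n) → ℝ}
    (hf : f ∈ testFunctions (ball 0 1)) (hf0 : f =ᶠ[𝓝 0] fun _ => 1) (hs : 0 ≤ s) :
    HasGradZero (ball 0 1) (fun x => f x * angular i s x) (gradient fun x => f x * angular i s x) := by
  have hsub : tsupport (fun x => f x * angular i s x) ⊆ tsupport f := tsupport_mul_subset_left
  refine ⟨hf.1.continuous.aestronglyMeasurable.mul measurable_angular.aestronglyMeasurable,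
    (measurable_gradient _).aestronglyMeasurable,
    fun x hx => by rw [testFunctions.apply_eq_zero hf hx, zero_mul],
    fun x hx => gradient_eq_zero_of_notMem_tsupport fun h => hx (hf.2.2 (hsub h)), ?_⟩
  obtain ⟨L, hL, hgrad⟩ := exists_norm_gradient_angular_le i
  obtain ⟨C, hC, hfC⟩ := testFunctions.exists_bound hf
  -- cut-offs equal to `1` near the origin and supported in the ball of radius `1 / (j + 1)`
  set η : ℕ → (𝔼 n) → ℝ := fun j x => f ((j + 1 : ℝ) • x) with hη
  have hηs : ∀ j, ContDiff ℝ ∞ (η j) := fun j => hf.1.comp (contDiff_const_smul _)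
  have hη1 : ∀ j, η j =ᶠ[𝓝 0] fun _ => 1 := fun j => by
    have : Tendsto (fun x : 𝔼 n => (j + 1 : ℝ) • x) (𝓝 0) (𝓝 0) := by
      have h := (continuous_const_smul (j + 1 : ℝ)).tendsto (0 : 𝔼 n)
      rwa [smul_zero] at h
    exact this.eventually hf0
  have hts : ∀ x ∈ tsupport f, ‖x‖ < 1 := fun x hx => mem_ball_zero_iff.1 (hf.2.2 hx)
  have hj0 : ∀ j : ℕ, (0 : ℝ) < j + 1 := fun j => by positivity
  have hηg : ∀ j x, ‖gradient (η j) x‖ = (j + 1) * ‖gradient f ((j + 1 : ℝ) • x)‖ := fun j x => by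
    rw [norm_gradient, norm_gradient, hη]
    simp only
    rw [fderiv_comp_smul, norm_smul, Real.norm_of_nonneg (hj0 j).le]
  have hηz : ∀ (j : ℕ) (x : 𝔼 n), 1 < (j + 1) * ‖x‖ → η j x = 0 ∧ gradient (η j) x = 0 := fun j x h => by
    have hnot : (j + 1 : ℝ) • x ∉ tsupport f := fun h' => by
      have := hts _ h'
      rw [norm_smul, Real.norm_of_nonneg (hj0 j).le] at this
      linarith
    refine ⟨image_eq_zero_of_notMem_tsupport (f := f) hnot, norm_eq_zero.1 ?_⟩
    rw [hηg, gradient_eq_zero_of_notMem_tsupport hnot, norm_zero, mul_zero]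
  -- `E j` measures the distance to the `j`-th approximant: it vanishes for `|x| > 1 / (j + 1)` and is
  -- dominated by the integrable function `D`
  set E : ℕ → (𝔼 n) → ℝ≥0∞ := fun j x => ‖η j x * angular i s x‖ₑ +
    ‖η j x • gradient (angular i s) x + angular i s x • gradient (η j) x‖ₑ with hE
  set D : (𝔼 n) → ℝ≥0∞ := fun x =>
    (ball (0 : 𝔼 n) 2).indicator (fun x => ENNReal.ofReal (C * s + s * C * (L + 1) * ‖x‖ ^ (-1 : ℝ))) x
    with hD
  have hEz : ∀ (j : ℕ) (x : 𝔼 n), 1 < (j + 1) * ‖x‖ → E j x = 0 := fun j x h => by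
    simp [hE, (hηz j x h).1, (hηz j x h).2]
  have hED : ∀ (j : ℕ) (x : 𝔼 n), x ≠ 0 → E j x ≤ D x := fun j x hx => by
    have hx' : 0 < ‖x‖ := norm_pos_iff.2 hx
    rcases lt_or_ge 1 ((j + 1) * ‖x‖) with h | h
    · rw [hEz j x h]; exact zero_le
    · have hb : x ∈ ball (0 : 𝔼 n) 2 := by
        rw [mem_ball_zero_iff]
        nlinarith [(Nat.cast_nonneg j : (0 : ℝ) ≤ j)]
      rw [hD]
      simp only
      rw [indicator_of_mem hb, hE]
      simp only
      rw [← ofReal_norm, ← ofReal_norm, ← ENNReal.ofReal_add (norm_nonneg _) (norm_nonneg _)]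
      refine ENNReal.ofReal_le_ofReal ?_
      have h1 : |η j x| ≤ C := (hfC _).1
      have h2 : ‖gradient (η j) x‖ ≤ C / ‖x‖ := by
        rw [hηg, le_div_iff₀ hx']
        calc (j + 1) * ‖gradient f ((j + 1 : ℝ) • x)‖ * ‖x‖ =
              ((j + 1) * ‖x‖) * ‖gradient f ((j + 1 : ℝ) • x)‖ := by ring
          _ ≤ 1 * C := mul_le_mul h (hfC _).2 (norm_nonneg _) zero_le_one
          _ = C := one_mul C
      have h3 := abs_angular_le (i := i) hs x
      have h4 := hgrad s hs x hx
      rw [Real.rpow_neg_one]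
      refine add_le_add ?_ ((norm_add_le _ _).trans ?_)
      · rw [norm_mul]
        exact mul_le_mul h1 h3 (abs_nonneg _) hC.le
      · rw [norm_smul, norm_smul, Real.norm_eq_abs, Real.norm_eq_abs]
        calc _ ≤ C * (s * L / ‖x‖) + s * (C / ‖x‖) := by gcongr
          _ = s * C * (L + 1) * ‖x‖⁻¹ := by ring
  have hDfin : ∫⁻ x, D x ≠ ⊤ := by
    have hfr : Module.finrank ℝ (𝔼 n) = n := finrank_euclideanSpace_fin
    have hmeas : Measurable fun x : 𝔼 n => ‖x‖ ^ (-1 : ℝ) := measurable_norm.pow_const _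
    have h1 : IntegrableOn (fun x : 𝔼 n => ‖x‖ ^ (-1 : ℝ)) (ball 0 2) :=
      integrableOn_ball_of_norm_le_rpow (C := 1) (α := 1) (by rw [hfr]; omega)
        (by rw [hfr]; exact_mod_cast hn) (.of_forall fun x => by
          rw [one_mul, Real.norm_of_nonneg (by positivity)]) hmeas.aestronglyMeasurable
    have h2 : IntegrableOn (fun x : 𝔼 n => C * s + s * C * (L + 1) * ‖x‖ ^ (-1 : ℝ)) (ball 0 2) :=
      (integrableOn_const (by exact measure_ball_lt_top.ne)).add (h1.const_mul _)
    rw [hD, lintegral_indicator measurableSet_ball]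
    exact ((lintegral_ofReal_le_lintegral_enorm _).trans_lt h2.2).ne
  have hne : ∀ᵐ x : 𝔼 n, x ≠ 0 := by
    have : Nontrivial (𝔼 n) := Module.nontrivial_of_finrank_pos (R := ℝ) (by
      rw [finrank_euclideanSpace_fin]; omega)
    exact Measure.ae_ne volume 0
  have hlim : Tendsto (fun j => ∫⁻ x, E j x) atTop (𝓝 0) := by
    have := tendsto_lintegral_of_dominated_convergence' (μ := volume) (F := E) (f := fun _ => 0)
      D (fun j => ?_) (fun j => hne.mono fun x hx => hED j x hx) hDfin ?_
    · simpa using this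
    · have m1 := (hηs j).continuous.measurable
      have m2 := measurable_gradient (η j)
      have m3 := measurable_gradient (angular i s)
      have m4 := measurable_angular (i := i) (s := s)
      exact ((m1.mul m4).enorm.add ((m1.smul m3).add (m4.smul m2)).enorm).aemeasurable
    · filter_upwards [hne] with x hx
      have hx' : 0 < ‖x‖ := norm_pos_iff.2 hx
      obtain ⟨N, hN⟩ := exists_nat_gt (1 / ‖x‖)
      refine tendsto_const_nhds.congr' ?_
      filter_upwards [eventually_ge_atTop N] with j hj
      refine (hEz j x ?_).symm
      rw [div_lt_iff₀ hx'] at hN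
      have : (N : ℝ) ≤ j := by exact_mod_cast hj
      nlinarith
  intro ε hε
  obtain ⟨j, hj⟩ := (hlim.eventually (gt_mem_nhds hε)).exists
  have hg : ContDiff ℝ ∞ fun x => f x - η j x := hf.1.sub (hηs j)
  have hg0 : (fun x => f x - η j x) =ᶠ[𝓝 0] 0 := by
    filter_upwards [hf0, hη1 j] with x h1 h2
    rw [h1, h2, sub_self, Pi.zero_apply]
  have hsupp : tsupport (fun x => (f x - η j x) * angular i s x) ⊆ ball 0 1 := by
    refine tsupport_mul_subset_left.trans ((tsupport_sub f (η j)).trans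
      (union_subset hf.2.2 fun x hx => ?_))
    have h1 : (j + 1 : ℝ) • x ∈ tsupport f :=
      tsupport_comp_subset_preimage f (continuous_const_smul (j + 1 : ℝ)) hx
    have h2 := hts _ h1
    rw [norm_smul, Real.norm_of_nonneg (hj0 j).le] at h2
    rw [mem_ball_zero_iff]
    nlinarith [(Nat.cast_nonneg j : (0 : ℝ) ≤ j), norm_nonneg x]
  refine ⟨_, ⟨contDiff_mul_angular hg hg0, Metric.isCompact_of_isClosed_isBounded
    (isClosed_tsupport _) (isBounded_ball.subset hsupp), hsupp⟩, lt_of_eq_of_lt ?_ hj⟩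
  refine lintegral_congr_ae ?_
  filter_upwards [hne] with x hx
  have hgr : gradient (fun x => f x - η j x) x = gradient f x - gradient (η j) x := by
    have h1 : DifferentiableAt ℝ (η j) x := (hηs j).differentiable (by simp) x
    have h2 := testFunctions.differentiable hf x
    simp [gradient, fderiv_fun_sub h2 h1]
  rw [gradient_mul_angular hf.1 hx, gradient_mul_angular hg hx, hgr, hE]
  simp only
  congr 2
  · ring
  · module

end Angular

/-- The Lavrentiev phenomenon for `p < n < n + κ < q`: the competitor `angular i s` has energy at
most a multiple of `s^p`, while every competitor that is regular at the origin pays at least a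
multiple of `s^q` in one of the two cones on which the weight is positive. -/
theorem exists_iInf_energySpace_lt {p q κ : ℝ} (hn : 2 ≤ n) (hp : 1 < p) (hpq : p < q) (hκ : 0 < κ)
    (hpn : p < n) (hq : (n : ℝ) + κ < q) (i : Fin n) :
    ∃ u₀ : (𝔼 n) → ℝ, MemW11 (ball 0 1) u₀ ∧
      energy p q (fun x => ell i x ^ κ) (ball 0 1) u₀ < ⊤ ∧
      (⨅ φ ∈ energySpace p q (fun x => ell i x ^ κ) (ball 0 1),
        energy p q (fun x => ell i x ^ κ) (ball 0 1) (u₀ + φ)) <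
      ⨅ ψ ∈ testFunctions (ball 0 1), energy p q (fun x => ell i x ^ κ) (ball 0 1) (u₀ + ψ) := by
  have hp0 : 0 < p := by linarith
  have hq0 : 0 < q := by linarith
  set a : (𝔼 n) → ℝ := fun x => ell i x ^ κ with ha
  set B : Set (𝔼 n) := ball 0 1 with hB
  have hBo : IsOpen B := isOpen_ball
  have haz : MemZ κ B a := memZ_ell_rpow hκ i B
  have ham : AEMeasurable a (volume.restrict B) := ((measurable_ell i).pow_const κ).aemeasurable
  obtain ⟨A₀, hA₀, haA⟩ := haz.exists_bound isBounded_ball hκ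
  let b : ContDiffBump (0 : 𝔼 n) := ⟨1 / 4, 1 / 2, by norm_num, by norm_num⟩
  have hbt : (b : (𝔼 n) → ℝ) ∈ testFunctions B := by
    refine ⟨b.contDiff, b.hasCompactSupport, ?_⟩
    rw [b.tsupport_eq]
    exact closedBall_subset_ball (by norm_num)
  have hb1 : (b : (𝔼 n) → ℝ) =ᶠ[𝓝 0] fun _ => 1 := b.eventuallyEq_one
  have hb0 : ∀ x : 𝔼 n, 1 / 2 ≤ ‖x‖ → b x = 0 := fun x hx =>
    b.zero_of_le_dist (by rwa [dist_zero_right])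
  have hc : ContDiff ℝ ∞ fun x : 𝔼 n => 1 - b x := contDiff_const.sub b.contDiff
  have hc0 : (fun x : 𝔼 n => 1 - b x) =ᶠ[𝓝 0] 0 := by
    filter_upwards [hb1] with x hx
    rw [hx, sub_self, Pi.zero_apply]
  obtain ⟨L, hL, hgrad⟩ := exists_norm_gradient_angular_le i
  have hnt : Nontrivial (𝔼 n) := Module.nontrivial_of_finrank_pos (R := ℝ) (by
    rw [finrank_euclideanSpace_fin]; omega)
  have hne : ∀ᵐ x : 𝔼 n, x ≠ 0 := Measure.ae_ne volume 0
  -- homogeneity gives the bound `s^p K`, where `K` is finite because `p < n`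
  obtain ⟨K, hK0, hK⟩ : ∃ K : ℝ, 0 ≤ K ∧ ∀ s : ℝ, 0 ≤ s →
      ∫⁻ x in B, density p q a x ‖gradient (angular i s) x‖ ≤ ENNReal.ofReal (s ^ p * K) := by
    have hfr : Module.finrank ℝ (𝔼 n) = n := finrank_euclideanSpace_fin
    have hmeas : Measurable fun x : 𝔼 n => ‖x‖ ^ (-p) := measurable_norm.pow_const _
    have h1 : IntegrableOn (fun x : 𝔼 n => ‖x‖ ^ (-p)) B :=
      integrableOn_ball_of_norm_le_rpow (C := 1) (α := p) (by rw [hfr]; omega)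
        (by rw [hfr]; exact hpn) (.of_forall fun x => by
          rw [one_mul, Real.norm_of_nonneg (by positivity)]) hmeas.aestronglyMeasurable
    refine ⟨L ^ p * ∫ x in B, ‖x‖ ^ (-p), mul_nonneg (by positivity)
      (integral_nonneg fun x => by positivity), fun s hs => ?_⟩
    rw [← mul_assoc, ENNReal.ofReal_mul (by positivity),
      ofReal_integral_eq_lintegral_ofReal h1 (.of_forall fun x => by positivity),
      ← lintegral_const_mul' _ _ ENNReal.ofReal_ne_top]
    refine lintegral_mono_ae ?_
    filter_upwards [ae_restrict_of_ae hne] with x hx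
    rw [density_gradient_angular hκ hq0, ← ENNReal.ofReal_mul (by positivity)]
    refine ENNReal.ofReal_le_ofReal ?_
    refine (Real.rpow_le_rpow (norm_nonneg _) (hgrad s hs x hx) hp0.le).trans (le_of_eq ?_)
    rw [Real.div_rpow (by positivity) (norm_nonneg _), Real.mul_rpow hs hL,
      Real.rpow_neg (norm_nonneg _), div_eq_mul_inv]
  have hcoord : Continuous fun y : 𝔼 n => y i := (contDiff_apply_coord i).continuous
  -- `σ = 1` selects the upper and `σ = -1` the lower cone
  have hcone : ∀ σ : ℝ, |σ| = 1 → ∃ c : ℝ, 0 < c ∧ ∀ (s : ℝ) (w : (𝔼 n) → ℝ) (ρ : ℝ), 0 < s →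
      ρ < 1 → ContDiff ℝ 1 w → (∀ x, ρ < ‖x‖ → 9 / 10 * ‖x‖ < σ * x i → w x = σ * s) →
      σ * w 0 ≤ 0 → ENNReal.ofReal (c * s ^ q) ≤ ∫⁻ x in B, density p q a x ‖gradient w x‖ := by
    intro σ hσ
    have hσ2 : σ * σ = 1 := by rw [← abs_mul_abs_self, hσ, one_mul]
    set A : Set (𝔼 n) := {y | 1 < ‖y‖ ∧ ‖y‖ < 2 ∧ 9 / 10 * ‖y‖ < σ * y i} with hA
    have hAo : IsOpen A := (isOpen_lt continuous_const continuous_norm).inter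
      ((isOpen_lt continuous_norm continuous_const).inter
        (isOpen_lt (continuous_const.mul continuous_norm) (continuous_const.mul hcoord)))
    have hAne : A.Nonempty := by
      refine ⟨EuclideanSpace.single i (σ * (3 / 2)), ?_⟩
      have h1 : ‖EuclideanSpace.single i (σ * (3 / 2))‖ = 3 / 2 := by
        rw [PiLp.norm_single, norm_mul, Real.norm_eq_abs, hσ]
        norm_num
      rw [hA, mem_ofPred_eq, h1]
      refine ⟨by norm_num, by norm_num, ?_⟩
      rw [PiLp.single_apply, if_pos rfl, ← mul_assoc, hσ2]
      norm_num
    obtain ⟨c, hc, hlow⟩ := exists_const_mul_rpow_le_energy (p := p) hκ (by omega : 1 ≤ n) hq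
      (i := i) hAo.measurableSet (fun y hy => hy.1.le) (fun y hy => hy.2.1.le)
      (fun y hy => by
        have := le_abs_self (σ * y i)
        rw [abs_mul, hσ, one_mul] at this
        exact hy.2.2.le.trans this) (hAo.measure_pos volume hAne)
    refine ⟨c, hc, fun s w ρ hs hρ hw hwc hw0 => hlow s w hs hw (fun y hy t ht htb => ?_)
      fun y hy => ?_⟩
    · -- near `t • y` the function is constant
      have h1 : 1 ≤ ‖t • y‖ := by simpa using htb
      have h2 : 9 / 10 * ‖t • y‖ < σ * (t • y) i := by
        rw [norm_smul, Real.norm_of_nonneg ht.le, PiLp.smul_apply, smul_eq_mul]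
        nlinarith [hy.2.2]
      have h3 : w =ᶠ[𝓝 (t • y)] fun _ => σ * s := by
        filter_upwards [(isOpen_lt continuous_const continuous_norm).mem_nhds (hρ.trans_le h1),
          (isOpen_lt (continuous_const.mul continuous_norm) (continuous_const.mul hcoord)).mem_nhds
            h2] with z hz1 hz2 using hwc z hz1 hz2
      rw [h3.gradient_eq, gradient_fun_const]
    · rw [hwc y (hρ.trans hy.1) hy.2.2]
      have h4 : σ * (σ * s - w 0) ≤ |σ * s - w 0| := by
        refine (le_abs_self _).trans ?_
        rw [abs_mul, hσ, one_mul]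
      have h5 : σ * (σ * s - w 0) = s - σ * w 0 := by rw [mul_sub, ← mul_assoc, hσ2, one_mul]
      linarith
  obtain ⟨c₁, hc₁, hlow₁⟩ := hcone 1 abs_one
  obtain ⟨c₂, hc₂, hlow₂⟩ := hcone (-1) (by simp)
  set c := min c₁ c₂ with hcdef
  have hcpos : 0 < c := lt_min hc₁ hc₂
  -- the amplitude `s` makes `c s^q` exceed `K s^p`
  obtain ⟨s, hs, hsK⟩ : ∃ s : ℝ, 0 < s ∧ s ^ p * K < c * s ^ q := by
    refine ⟨(K / c + 1) ^ (q - p)⁻¹, by positivity, ?_⟩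
    set s := (K / c + 1) ^ (q - p)⁻¹ with hs
    have hs0 : 0 < s := by positivity
    have h1 : s ^ (q - p) = K / c + 1 := Real.rpow_inv_rpow (by positivity) (by linarith)
    have h2 : s ^ q = s ^ p * s ^ (q - p) := by rw [← Real.rpow_add hs0, add_sub_cancel]
    rw [h2, h1]
    have h3 : 0 < s ^ p := by positivity
    have h4 : c * (s ^ p * (K / c + 1)) = s ^ p * K + s ^ p * c := by field_simp
    rw [h4]
    linarith [mul_pos h3 hcpos]
  set u₀ : (𝔼 n) → ℝ := fun x => (1 - b x) * angular i s x with hu₀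
  have hu₀s : ContDiff ℝ ∞ u₀ := contDiff_mul_angular hc hc0
  have hu₀1 : ContDiff ℝ 1 u₀ := hu₀s.of_le (by simp)
  have hu₀w : HasWeakGradient B u₀ (gradient u₀) := hasWeakGradient_of_contDiff hu₀1
  refine ⟨u₀, ⟨⟨_, hu₀w⟩, ?_, ?_⟩, ?_, ?_⟩
  · exact (hu₀s.continuous.continuousOn.integrableOn_compact (isCompact_closedBall 0 1)).mono_set
      ball_subset_closedBall
  · refine IntegrableOn.congr_fun_ae ?_ (hu₀w.weakGrad_ae_eq hBo).symm
    exact ((continuous_gradient hu₀1).continuousOn.integrableOn_compact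
      (isCompact_closedBall 0 1)).mono_set ball_subset_closedBall
  · rw [energy_eq hBo hu₀w]
    obtain ⟨M, hM⟩ := (isCompact_closedBall (0 : 𝔼 n) 1).exists_bound_of_continuousOn
      (continuous_gradient hu₀1).continuousOn
    exact setLIntegral_density_lt_top_of_bounded hp0 hq0 hBo.measurableSet isBounded_ball haz.1 haA
      fun x hx => hM x (ball_subset_closedBall hx)
  set φ : (𝔼 n) → ℝ := fun x => b x * angular i s x with hφ
  have hφz : HasGradZero B φ (gradient φ) := hasGradZero_mul_angular hn hbt hb1 hs.le
  have hφE : φ ∈ energySpace p q a B := by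
    refine ⟨hφz.memW110 hBo, ?_⟩
    rw [energy_eq hBo (hφz.hasWeakGradient B)]
    obtain ⟨M, hM0, hM⟩ := testFunctions.exists_bound hbt
    have m1 : AEStronglyMeasurable (fun x => b x • gradient (angular i s) x)
        (volume.restrict B) :=
      b.continuous.aestronglyMeasurable.smul (measurable_gradient _).aestronglyMeasurable
    have h1 := setLIntegral_density_add_le hp hpq hBo.measurableSet haz.1 ham m1
      (W := fun x => angular i s x • gradient b x)
    have h2 : ∫⁻ x in B, density p q a x ‖gradient φ x‖ = ∫⁻ x in B, density p q a x
        ‖b x • gradient (angular i s) x + angular i s x • gradient b x‖ := by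
      refine lintegral_congr_ae ?_
      filter_upwards [ae_restrict_of_ae hne] with x hx
      rw [hφ, gradient_mul_angular hbt.1 hx]
    rw [h2]
    refine h1.trans_lt (ENNReal.mul_lt_top ENNReal.ofReal_lt_top (ENNReal.add_lt_top.2 ⟨?_, ?_⟩))
    · refine lt_of_le_of_lt (setLIntegral_mono' hBo.measurableSet fun x hx => ?_)
        ((hK s hs.le).trans_lt ENNReal.ofReal_lt_top)
      refine density_mono hp0 hq0 (haz.1 x hx) (norm_nonneg _) ?_
      rw [norm_smul, Real.norm_of_nonneg b.nonneg]
      exact mul_le_of_le_one_left (norm_nonneg _) b.le_one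
    · refine setLIntegral_density_lt_top_of_bounded hp0 hq0 hBo.measurableSet isBounded_ball haz.1
        haA (B := s * M) fun x _ => ?_
      rw [norm_smul]
      exact mul_le_mul (abs_angular_le hs.le x) (hM x).2 (norm_nonneg _) hs.le
  have hup : (⨅ φ ∈ energySpace p q a B, energy p q a B (u₀ + φ)) ≤
      ENNReal.ofReal (s ^ p * K) := by
    refine (iInf₂_le φ hφE).trans (le_trans (le_of_eq ?_) (hK s hs.le))
    rw [energy_eq hBo (hu₀w.add (hφz.hasWeakGradient B))]
    refine lintegral_congr_ae ?_
    filter_upwards [ae_restrict_of_ae hne] with x hx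
    congr 2
    have h1 : gradient (fun x => 1 - b x) x = - gradient b x := by
      simp [gradient, fderiv_const_sub]
    rw [Pi.add_apply, hu₀, hφ, gradient_mul_angular hc hx, gradient_mul_angular hbt.1 hx, h1]
    module
  have hdown : ENNReal.ofReal (c * s ^ q) ≤
      ⨅ ψ ∈ testFunctions B, energy p q a B (u₀ + ψ) := by
    refine le_iInf₂ fun ψ hψ => ?_
    set w : (𝔼 n) → ℝ := u₀ + ψ with hw
    have hw1 : ContDiff ℝ 1 w := hu₀1.add (by simpa using testFunctions.contDiff hψ 1)
    rw [energy_eq hBo (hasWeakGradient_of_contDiff hw1)]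
    obtain ⟨ρ, hρ0, hρ1, hρ⟩ : ∃ ρ : ℝ, 1 / 2 ≤ ρ ∧ ρ < 1 ∧ ∀ x, ρ < ‖x‖ → ψ x = 0 := by
      obtain ⟨r, hr, hr'⟩ := exists_lt_subset_ball (isClosed_tsupport ψ) hψ.2.2
      refine ⟨max (1 / 2) r, le_max_left _ _, max_lt (by norm_num) hr, fun x hx => ?_⟩
      refine image_eq_zero_of_notMem_tsupport fun h => ?_
      have := mem_ball_zero_iff.1 (hr' h)
      exact absurd ((le_max_right (1 / 2) r).trans_lt hx) (not_lt.2 this.le)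
    have hwx : ∀ x, ρ < ‖x‖ → w x = angular i s x := fun x hx => by
      rw [hw, Pi.add_apply, hρ x hx, hu₀]
      simp only
      rw [hb0 x (hρ0.trans hx.le)]
      ring
    have hx0 : ∀ x : 𝔼 n, ρ < ‖x‖ → x ≠ 0 := fun x hx => norm_pos_iff.1 (by linarith)
    have hsq : (0 : ℝ) ≤ s ^ q := by positivity
    rcases le_total (w 0) 0 with h0 | h0
    · refine le_trans (ENNReal.ofReal_le_ofReal ?_)
        (hlow₁ s w ρ hs hρ1 hw1 (fun x hx hxi => ?_) (by linarith))
      · exact mul_le_mul_of_nonneg_right (min_le_left _ _) hsq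
      · rw [hwx x hx, angular_eq (hx0 x hx) (by linarith [norm_nonneg x]), one_mul]
    · refine le_trans (ENNReal.ofReal_le_ofReal ?_)
        (hlow₂ s w ρ hs hρ1 hw1 (fun x hx hxi => ?_) (by linarith))
      · exact mul_le_mul_of_nonneg_right (min_le_right _ _) hsq
      · rw [hwx x hx, angular_eq_neg (hx0 x hx) (by linarith [norm_nonneg x]), neg_one_mul]
  refine hup.trans_lt (lt_of_lt_of_le ?_ hdown)
  exact (ENNReal.ofReal_lt_ofReal_iff (by positivity)).2 hsK

end DoublePhase

end

theorem mainTheorem1 (n : ℕ) (hn : 2 ≤ n) (p q κ : ℝ) (hp : 1 < p) (hpq : p < q) (hκ : 0 < κ) :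
    (q ≤ p + κ →
      ∀ (Ω : Set (EuclideanSpace ℝ (Fin n))) (a u₀ : EuclideanSpace ℝ (Fin n) → ℝ),
        DoublePhase.IsLipschitzDomain Ω →
        AEMeasurable a (volume.restrict Ω) →
        DoublePhase.MemZ κ Ω a →
        DoublePhase.WeaklyDifferentiable Ω u₀ →
        DoublePhase.energy p q a Ω u₀ < ⊤ →
        (⨅ φ ∈ DoublePhase.energySpace p q a Ω, DoublePhase.energy p q a Ω (u₀ + φ)) =
          (⨅ ψ ∈ DoublePhase.testFunctions Ω, DoublePhase.energy p q a Ω (u₀ + ψ))) ∧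
    (p < n → (n : ℝ) + κ < q →
      ∃ (Ω : Set (EuclideanSpace ℝ (Fin n))) (a u₀ : EuclideanSpace ℝ (Fin n) → ℝ),
        Ω = ball 0 1 ∧
        a = (fun x => DoublePhase.ell ⟨n - 1, by omega⟩ x ^ κ) ∧
        DoublePhase.IsLipschitzDomain Ω ∧
        DoublePhase.MemZ κ Ω a ∧
        DoublePhase.MemW11 Ω u₀ ∧
        DoublePhase.energy p q a Ω u₀ < ⊤ ∧
        (⨅ φ ∈ DoublePhase.energySpace p q a Ω, DoublePhase.energy p q a Ω (u₀ + φ)) <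
          (⨅ ψ ∈ DoublePhase.testFunctions Ω, DoublePhase.energy p q a Ω (u₀ + ψ))) := by
  refine ⟨fun hqκ Ω a u₀ hΩ ham haz hu₀ _ =>
    DoublePhase.iInf_energySpace_eq_iInf_testFunctions hp hpq hκ hqκ hΩ ham haz hu₀,
    fun hpn hq => ?_⟩
  obtain ⟨u₀, hu₀, hfin, hlt⟩ := DoublePhase.exists_iInf_energySpace_lt hn hp hpq hκ hpn hq
    ⟨n - 1, by omega⟩
  exact ⟨ball 0 1, _, u₀, rfl, rfl, DoublePhase.isLipschitzDomain_ball,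
    DoublePhase.memZ_ell_rpow hκ _ _, hu₀, hfin, hlt⟩
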